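/- **Notation.** Semi-infinite matrices have complex entries and rows and columns indexed by $0,1,2,\dots$; all products below involve finite sums only. $\Lambda$ is the shift matrix, $\Lambda_{ij}=\delta_{j,i+1}$, $J$ is block diagonal with $2\times2$ diagonal blocks $\begin{pmatrix}0&1\\-1&0\end{pmatrix}$, and $\mathcal J(a)=Ja^{\top}J$. Divide a matrix $a$ into $2\times 2$ blocks and write $a=a_-+a_0+a_+$ for its parts strictly below, on, and strictly above the block diagonal. Let $\mathcal D_0^-$ be the block diagonal matrices all of whose diagonal blocks are multiples of the identity, let $\mathbf k$ be the matrices $a$ with $a_+=0$ and $a_0\in\mathcal D_0^-$, and let $\mathcal G_{\mathbf k}$ be the group of elements of $\mathbf k$ that are invertible in $\mathbf k$. Let $\mathbf n=\{a:\mathcal J(a)=a\}$, and let $\pi_{\mathbf k}a=(a_--\mathcal J(a_+))+\tfrac12(a_0-\mathcal J(a_0))$ be the projection onto $\mathbf k$ along $\mathbf n$. The Pfaffian of a skew-symmetric $2n\times2n$ matrix is $\mathrm{pf}(a)=\frac1{2^nn!}\sum_{\sigma}\varepsilon(\sigma)\prod_{r=0}^{n-1}a_{\sigma(2r),\sigma(2r+1)}$.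 Let $U\subseteq\mathbb C^\infty$ be a set of times $t=(t_1,t_2,\dots)$. For a function $f$ on $U$, $\partial f/\partial t_k=a$ at $t\in U$ means that $(f(t+se_k)-f(t))/s\to a$ as $s\to0$, $s\ne0$, $t+se_k\in U$ (the complex partial derivative if $U$ is open, the real one if $U=\mathbb R^\infty$); for matrices and polynomials in $z$ it is taken entrywise and coefficientwise. **Theorem 3.1.** For $t\in U$ let $m(t)=m_\infty(t)=(\mu_{ij}(t))_{i,j\ge0}$ be skew-symmetric, and suppose that on $U$ $$\frac{\partial m}{\partial t_k}=\Lambda^km+m\Lambda^{\top k}\qquad(k=1,2,\dots)$$ and that $\tilde\tau_{2n}(t):=\mathrm{pf}\,(\mu_{ij}(t))_{0\le i,j\le 2n-1}\ne0$ for all $n\ge0$ and $t\in U$ ($\tilde\tau_0=1$). Let $\langle\cdot,\cdot\rangle$ be the bilinear form on polynomials with $\langle y^i,z^j\rangle=\mu_{ij}(t)$, put $\tilde h_{2n}=\tilde\tau_{2n+2}/\tilde\tau_{2n}$, $\tilde h=\mathrm{diag}(\tilde h_0,\tilde h_0,\tilde h_2,\tilde h_2,\dots)$, and define $$p_{2n}(t,z)=\frac1{\tilde\tau_{2n}}\,\mathrm{pf}\begin{pmatrix}0&\mu_{01}&\cdots&\mu_{0,2n}&1\\-\mu_{01}&0&\cdots&\mu_{1,2n}&z\\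 \vdots&\vdots&&\vdots&\vdots\\-\mu_{0,2n}&-\mu_{1,2n}&\cdots&0&z^{2n}\\-1&-z&\cdots&-z^{2n}&0\end{pmatrix},$$ $$p_{2n+1}(t,z)=-\frac1{\tilde\tau_{2n}}\,\mathrm{pf}\begin{pmatrix}0&\mu_{01}&\cdots&1&\mu_{0,2n+1}\\-\mu_{01}&0&\cdots&z&\mu_{1,2n+1}\\ \vdots&\vdots&&\vdots&\vdots\\-1&-z&\cdots&0&-z^{2n+1}\\-\mu_{0,2n+1}&-\mu_{1,2n+1}&\cdots&z^{2n+1}&0\end{pmatrix}$$ (in $(\mu_{ij})_{0\le i,j\le 2n+1}$ the last, respectively last but one, row and column are replaced by $\mp$ the powers of $z$, with $0$ where they cross). Then on $U$: 1. $p_k$ is monic of degree $k$, $\tilde h\in\mathcal D_0^-$, and $(\langle p_i,p_j\rangle)_{i,j\ge0}=J\tilde h$. 2. $p_{2n+1}=\tilde\tau_{2n}^{-1}\left(z+\dfrac{\partial}{\partial t_1}\right)\tilde\tau_{2n}\,p_{2n}$ for all $n\ge0$. 3. Choose square roots $\sqrt{\tilde h_{2n}(t)}$ in any way, put $q_{2n}=p_{2n}/\sqrt{\tilde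 h_{2n}}$, $q_{2n+1}=p_{2n+1}/\sqrt{\tilde h_{2n}}$, and let $Q$ be the matrix with $q(z)=Q\,(1,z,z^2,\dots)^\top$. Then $(\langle q_i,q_j\rangle)_{i,j\ge0}=J$, and $Q$ solves the skew-Borel decomposition $$m=Q^{-1}JQ^{\top-1},\qquad Q\in\mathcal G_{\mathbf k}.$$ The solutions of this decomposition are exactly the matrices $\mathrm{diag}(\varepsilon_0,\varepsilon_0,\varepsilon_1,\varepsilon_1,\dots)\,Q$ with $\varepsilon_n=\pm1$. 4. $L=Q\Lambda Q^{-1}$ is the only matrix with $z\,q(z)=L\,q(z)$. At every $t\in U$ and for every $k\ge1$ such that all the chosen roots $\sqrt{\tilde h_{2n}}$ are continuous at $t$ in the direction $t_k$ (within $U$), $$\frac{\partial L}{\partial t_k}=\left[-\pi_{\mathbf k}L^k,\,L\right];$$ for each given $t\in U$ there is a choice of roots on $U$ that is continuous at $t$ in all directions $t_k$. Moreover $$\tilde h^{-1}\frac{\partial\tilde h}{\partial t_k}=2\pi_{\mathbf k}\big((L^k)_0\big)\qquad(k=1,2,\dots).$$ -/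

import Mathlib

open Polynomial

noncomputable section

/-! ### Semi-infinite matrices -/

/-- Semi-infinite complex matrices, rows and columns indexed by `0, 1, 2, …`. -/
abbrev SMat : Type := Matrix ℕ ℕ ℂ

/-- The product of semi-infinite matrices, `(A B)_{ij} = ∑_k A_{ik} B_{kj}`. It is only used where
every such sum has finitely many nonzero terms (`A` has finite rows or `B` has finite columns). -/
def smatMul (A B : SMat) : SMat :=
  Matrix.of fun i j => ∑ᶠ k : ℕ, A i k * B k j

infixl:70 " ⋆ " => smatMul

/-- Powers of a semi-infinite matrix. -/
def spow (A : SMat) : ℕ → SMat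
  | 0 => 1
  | n + 1 => spow A n ⋆ A

/-- The commutator `[A, B] = A B - B A`. -/
def scomm (A B : SMat) : SMat := A ⋆ B - B ⋆ A

/-- The shift matrix `Λ`, with `(Λ v)_i = v_{i+1}`. -/
def shiftMat : SMat := Matrix.of fun i j => if j = i + 1 then 1 else 0

/-- The block diagonal matrix `J` with diagonal blocks `(0, 1; -1, 0)`. -/
def Jmat : SMat := Matrix.of fun i j =>
  if i % 2 = 0 ∧ j = i + 1 then 1 else if j % 2 = 0 ∧ i = j + 1 then -1 else 0

/-- The involution `𝒥 a = J aᵀ J`. -/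
def calJ (a : SMat) : SMat := Jmat ⋆ a.transpose ⋆ Jmat

/-! ### The splitting into `2 × 2` blocks -/

/-- `a₋`: the part of `a` strictly below the `2 × 2` diagonal blocks. -/
def lowerPart (a : SMat) : SMat := Matrix.of fun i j => if j / 2 < i / 2 then a i j else 0

/-- `a₀`: the part of `a` in the `2 × 2` diagonal blocks. -/
def diagPart (a : SMat) : SMat := Matrix.of fun i j => if i / 2 = j / 2 then a i j else 0

/-- `a₊`: the part of `a` strictly above the `2 × 2` diagonal blocks. -/
def upperPart (a : SMat) : SMat := Matrix.of fun i j => if i / 2 < j / 2 then a i j else 0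

/-- `a ∈ 𝒟₀⁻`: block diagonal, every `2 × 2` diagonal block being a multiple of the identity. -/
def IsD0minus (a : SMat) : Prop := ∃ c : ℕ → ℂ, a = Matrix.diagonal fun i => c (i / 2)

/-- `a ∈ 𝐤 = 𝒟₋ ⊕ 𝒟₀⁻`. -/
def IsK (a : SMat) : Prop := upperPart a = 0 ∧ IsD0minus (diagPart a)

/-- `a ∈ 𝐧 = sp(∞)`, the fixed point set of `𝒥`. -/
def IsN (a : SMat) : Prop := calJ a = a

/-- The projection `π_𝐤` onto `𝐤` along `𝐧`,
`π_𝐤 a = (a₋ - 𝒥 a₊) + (a₀ - 𝒥 a₀) / 2`; see `piK_spec`. -/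
def piK (a : SMat) : SMat :=
  (lowerPart a - calJ (upperPart a)) + (1 / 2 : ℂ) • (diagPart a - calJ (diagPart a))

/-- `Q ∈ 𝒢_𝐤`: the group of invertible elements of `𝐤`. -/
def IsGK (Q : SMat) : Prop := IsK Q ∧ ∃ R : SMat, IsK R ∧ Q ⋆ R = 1 ∧ R ⋆ Q = 1

open Classical in
/-- The inverse in `𝒢_𝐤` (and `0` for a matrix that is not in `𝒢_𝐤`). -/
def gInv (Q : SMat) : SMat :=
  if h : ∃ R : SMat, IsK R ∧ Q ⋆ R = 1 ∧ R ⋆ Q = 1 then h.choose else 0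

/-- The skew-Borel decomposition `m = Q⁻¹ J (Qᵀ)⁻¹` with `Q ∈ 𝒢_𝐤`. -/
def IsSkewBorel (m Q : SMat) : Prop :=
  IsGK Q ∧ m = gInv Q ⋆ Jmat ⋆ (gInv Q).transpose

/-- The other index in the same `2 × 2` block. -/
def partner (i : ℕ) : ℕ := if i % 2 = 0 then i + 1 else i - 1

/-- The sign of the nonzero entry of row `i` of `J`. -/
def rowSign (i : ℕ) : ℂ := if i % 2 = 0 then 1 else -1

theorem Jmat_apply (i j : ℕ) : Jmat i j = if j = partner i then rowSign i else 0 := by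
  simp only [Jmat, partner, rowSign, Matrix.of_apply]
  split_ifs <;> first | rfl | omega

theorem calJ_apply (a : SMat) (i j : ℕ) :
    calJ a i j = -(rowSign i * rowSign j * a (partner j) (partner i)) := by
  have h1 : ∀ (b : SMat) (i j : ℕ), (Jmat ⋆ b) i j = rowSign i * b (partner i) j := by
    intro b i j
    simp only [smatMul, Matrix.of_apply]
    rw [finsum_eq_single _ (partner i)]
    · simp [Jmat_apply]
    · intro k hk
      simp [Jmat_apply, hk]
  have h2 : ∀ (b : SMat) (i j : ℕ), (b ⋆ Jmat) i j = -(b i (partner j) * rowSign j) := by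
    intro b i j
    simp only [smatMul, Matrix.of_apply]
    rw [finsum_eq_single _ (partner j)]
    · have : Jmat (partner j) j = -rowSign j := by
        simp only [Jmat, partner, rowSign, Matrix.of_apply]
        split_ifs <;> first | rfl | omega | simp
      rw [this]; ring
    · intro k hk
      have : Jmat k j = 0 := by
        rw [Jmat_apply, if_neg]
        intro h; apply hk; subst h
        simp only [partner]; split_ifs <;> omega
      simp [this]
  rw [calJ, h2, h1, Matrix.transpose_apply]; ring

/-- `piK a` is the unique `b ∈ 𝐤` with `a - b ∈ 𝐧`. -/
theorem piK_spec (a b : SMat) : (IsK b ∧ IsN (a - b)) ↔ b = piK a := by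
  have hp2 : ∀ i, partner i / 2 = i / 2 := by
    intro i; simp only [partner]; split_ifs <;> omega
  have hpp : ∀ i, partner (partner i) = i := by
    intro i; simp only [partner]; split_ifs <;> omega
  have hss : ∀ i, rowSign i * rowSign i = 1 := by
    intro i; simp only [rowSign]; split_ifs <;> simp
  have hsp : ∀ i, rowSign (partner i) = -rowSign i := by
    intro i; simp only [rowSign, partner]; split_ifs <;> first | omega | simp
  have hval : ∀ i j, piK a i j = (if j / 2 < i / 2 then a i j else 0)
      + rowSign i * rowSign j * (if j / 2 < i / 2 then a (partner j) (partner i) else 0)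
      + 1 / 2 * ((if i / 2 = j / 2 then a i j else 0)
      + rowSign i * rowSign j * (if i / 2 = j / 2 then a (partner j) (partner i) else 0)) := by
    intro i j
    simp only [piK, Matrix.add_apply, Matrix.sub_apply, Matrix.smul_apply, calJ_apply,
      lowerPart, upperPart, diagPart, Matrix.of_apply, hp2, smul_eq_mul, eq_comm (a := j / 2)]
    ring
  have hcases : ∀ i j : ℕ, i / 2 = j / 2 → j = i ∨ j = partner i := by
    intro i j h; simp only [partner]; split_ifs <;> omega
  constructor
  · rintro ⟨⟨hu, c, hc⟩, hn⟩
    have hu' : ∀ i j, i / 2 < j / 2 → b i j = 0 := by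
      intro i j h
      have := congrFun (congrFun hu i) j
      simpa [upperPart, h] using this
    have hd : ∀ i j, i / 2 = j / 2 → b i j = if i = j then c (i / 2) else 0 := by
      intro i j h
      have := congrFun (congrFun hc i) j
      simpa [diagPart, h, Matrix.diagonal_apply] using this
    have hn' : ∀ i j, a i j - b i j = -(rowSign i * rowSign j *
        (a (partner j) (partner i) - b (partner j) (partner i))) := by
      intro i j
      have := congrFun (congrFun hn i) j
      rw [calJ_apply] at this
      simpa using this.symm
    ext i j
    rw [hval]
    rcases lt_trichotomy (i / 2) (j / 2) with h | h | h
    · rw [hu' i j h]; simp [h.ne, h.not_gt]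
    · have e := hn' i j
      have hb : rowSign i * rowSign j * b (partner j) (partner i) = b i j := by
        rw [hd i j h, hd _ _ (by rw [hp2, hp2, h])]
        by_cases hij : i = j
        · subst hij; simp [hp2, hss]
        · have : partner j ≠ partner i := fun h' => hij (by rw [← hpp i, ← h', hpp])
          simp [hij, this]
      simp only [h, lt_irrefl, if_true, if_false]
      linear_combination (-1 / 2) * e - (1 / 2) * hb
    · have e := hn' i j
      have hb := hu' (partner j) (partner i) (by rw [hp2, hp2]; exact h)
      simp only [h, h.ne', if_true, if_false]
      rw [hb] at e
      linear_combination -e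
  · rintro rfl
    refine ⟨⟨?_, fun n => (a (2 * n) (2 * n) + a (2 * n + 1) (2 * n + 1)) / 2, ?_⟩, ?_⟩
    · ext i j
      by_cases h : i / 2 < j / 2
      · simp [upperPart, h, hval, h.ne, h.not_gt]
      · simp [upperPart, h]
    · ext i j
      by_cases h : i / 2 = j / 2
      · rcases hcases i j h with rfl | rfl
        · simp only [diagPart, Matrix.of_apply, hval, if_true, lt_irrefl, if_false, hss,
            Matrix.diagonal_apply]
          rcases Nat.even_or_odd' j with ⟨k, rfl | rfl⟩
          · have : partner (2 * k) = 2 * k + 1 := by simp [partner]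
            have h2 : 2 * k / 2 = k := by omega
            rw [this, h2]; ring
          · have : partner (2 * k + 1) = 2 * k := by simp [partner]
            have h2 : (2 * k + 1) / 2 = k := by omega
            rw [this, h2]; ring
        · have hne : i ≠ partner i := by simp only [partner]; split_ifs <;> omega
          simp only [diagPart, Matrix.of_apply, hval, hp2, if_true, lt_irrefl, if_false, hsp, hpp,
            Matrix.diagonal_apply, if_neg hne]
          linear_combination (-1 / 2 * a i (partner i)) * hss i
      · have : i ≠ j := fun h' => h (by rw [h'])
        simp [diagPart, h, this]
    · ext i j
      rw [calJ_apply]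
      simp only [Matrix.sub_apply, hval, hp2, hpp, hsp]
      have e : rowSign i * rowSign j * (rowSign i * rowSign j) = 1 := by
        linear_combination (rowSign j * rowSign j) * hss i + hss j
      rcases lt_trichotomy (i / 2) (j / 2) with h | h | h
      · simp only [h, h.ne, h.ne', h.not_gt, if_true, if_false]
        linear_combination (a i j) * e
      · simp only [h, lt_irrefl, if_true, if_false]
        linear_combination (1 / 2 * a i j) * e
      · simp only [h, h.ne, h.ne', h.not_gt, if_true, if_false]
        ring

/-! ### Pfaffians -/

/-- The Pfaffian of a skew-symmetric matrix of size `2n`,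
`(2ⁿ n!)⁻¹ ∑_σ ε(σ) ∏_{r < n} a_{σ(2r), σ(2r+1)}`. -/
def pfaffian {R : Type*} [CommRing R] [Algebra ℚ R] (n : ℕ)
    (A : Matrix (Fin (2 * n)) (Fin (2 * n)) R) : R :=
  (1 / (2 ^ n * (n.factorial : ℚ))) •
    ∑ σ : Equiv.Perm (Fin (2 * n)), ((Equiv.Perm.sign σ : ℤ) : R) *
      ∏ r : Fin n, A (σ ⟨2 * r, by omega⟩) (σ ⟨2 * r + 1, by omega⟩)

/-- `τ̃_{2n} = pf(0, …, 2n-1)`. -/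
def tauT (m : SMat) (n : ℕ) : ℂ :=
  pfaffian n (Matrix.of fun a b : Fin (2 * n) => m a b)

/-- The `(2n+2) × (2n+2)` matrix `(m_{ab})_{0 ≤ a, b ≤ 2n+1}` in which column `c` is replaced by
`(1, z, z², …)ᵀ` and row `c` by `(-1, -z, -z², …)`, with `0` at their crossing. -/
def bordered (m : SMat) (n c : ℕ) : Matrix (Fin (2 * (n + 1))) (Fin (2 * (n + 1))) ℂ[X] :=
  Matrix.of fun a b =>
    if (a : ℕ) = c then (if (b : ℕ) = c then 0 else -X ^ (b : ℕ))
    else if (b : ℕ) = c then X ^ (a : ℕ) else C (m a b)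

/-- The polynomials `p_k`: for `k = 2n` the border is put in the last place `2n+1`, for `k = 2n+1`
in the place `2n`. The minus sign for odd `k` makes `p_k` monic. -/
def pPoly (m : SMat) (k : ℕ) : ℂ[X] :=
  if k % 2 = 0 then C (tauT m (k / 2))⁻¹ * pfaffian (k / 2 + 1) (bordered m (k / 2) (k + 1))
  else -(C (tauT m (k / 2))⁻¹ * pfaffian (k / 2 + 1) (bordered m (k / 2) (k - 1)))

/-- The diagonal entries `h̃_{2n}, h̃_{2n}` of `h̃`, where `h̃_{2n} = τ̃_{2n+2} / τ̃_{2n}`;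
the argument is `n`. -/
def hT (m : SMat) (n : ℕ) : ℂ := tauT m (n + 1) / tauT m n

/-- `h̃ = diag(h̃₀, h̃₀, h̃₂, h̃₂, …)`. -/
def hMat (m : SMat) : SMat := Matrix.diagonal fun i => hT m (i / 2)

/-- `h̃⁻¹`. -/
def hMatInv (m : SMat) : SMat := Matrix.diagonal fun i => (hT m (i / 2))⁻¹

/-- The skew inner product with `⟨yⁱ, zʲ⟩ = m_{ij}`, extended bilinearly to polynomials. -/
def skewInner (m : SMat) (f g : ℂ[X]) : ℂ :=
  f.sum fun i a => g.sum fun j b => a * b * m i j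

/-- The normalized polynomials `q_{2n} = p_{2n} / √h̃_{2n}`, `q_{2n+1} = p_{2n+1} / √h̃_{2n}`;
`r n` is the chosen square root of `h̃_{2n}`. -/
def qPoly (m : SMat) (r : ℕ → ℂ) (k : ℕ) : ℂ[X] := C (r (k / 2))⁻¹ * pPoly m k

/-- The matrix `Q` of coefficients, `q(z) = Q (1, z, z², …)ᵀ`. -/
def QMat (m : SMat) (r : ℕ → ℂ) : SMat := Matrix.of fun i j => (qPoly m r i).coeff j

/-- `L = Q Λ Q⁻¹`. -/
def LMat (m : SMat) (r : ℕ → ℂ) : SMat := QMat m r ⋆ shiftMat ⋆ gInv (QMat m r)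

/-! ### Time derivatives -/

/-- Times `t = (t₁, t₂, …) ∈ ℂ^∞`. -/
abbrev Times : Type := ℕ+ → ℂ

/-- The increments along the `t_k`-axis that stay in `U`. -/
def slice (U : Set Times) (k : ℕ+) (t : Times) : Set ℂ := {s | t + Pi.single k s ∈ U}

/-- `∂f/∂t_k = f'` at `t`, the difference quotients being taken along the `t_k`-axis inside `U`.
For `U` open this is the complex partial derivative, for `U` inside `ℝ^∞` the real one. -/
def HasPartial (U : Set Times) (k : ℕ+) (f : Times → ℂ) (f' : ℂ) (t : Times) : Prop :=
  HasDerivWithinAt (fun s : ℂ => f (t + Pi.single k s)) f' (slice U k t) 0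

/-- Entrywise partial derivative of a semi-infinite matrix. -/
def HasMatPartial (U : Set Times) (k : ℕ+) (F : Times → SMat) (F' : SMat) (t : Times) : Prop :=
  ∀ i j : ℕ, HasPartial U k (fun u => F u i j) (F' i j) t

/-- Coefficientwise partial derivative of a polynomial in `z`. -/
def HasPolyPartial (U : Set Times) (k : ℕ+) (F : Times → ℂ[X]) (F' : ℂ[X]) (t : Times) : Prop :=
  ∀ j : ℕ, HasPartial U k (fun u => (F u).coeff j) (F'.coeff j) t

/-- Continuity of `f` at `t` along the `t_k`-axis inside `U`. -/
def ContAlong (U : Set Times) (k : ℕ+) (f : Times → ℂ) (t : Times) : Prop :=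
  ContinuousWithinAt (fun s : ℂ => f (t + Pi.single k s)) (slice U k t) 0

end

open Polynomial

noncomputable section

/-! Each term of a bordered Pfaffian is linear in the border, so a linear functional `φ` can be
applied to `p_k` by putting the numbers `φ (X ^ a)` in the border (`map_pfaffian_bordered`).
Coefficient functionals give the leading coefficients: the border then vanishes before place `2n`
and the Pfaffian collapses to `τ̃_{2n}` (`isKWith_PMat`). The functional `⟨·, z^j⟩` turns the border
into a copy of index `j`: a repeated index gives zero, and the one non-repeated case gives
`τ̃_{2n+2}` (`pfaffian_borderedBy_pair`). This is skew-orthogonality, and after normalization it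
reads `Q m Qᵀ = J` (`QMat_conj`).

That identity displays `-m Qᵀ J` as a right inverse of the triangular matrix `Q`, hence as its
inverse in the group. Two solutions of the decomposition differ by an element of `𝐤` preserving `J`;
it is at once lower and upper block triangular, so it is a diagonal of signs
(`IsKWith.eq_diagonal`).

The flow acts on `m` by raising indices. In the `t₁`-derivative of the Pfaffian defining `p_{2n}`,
raising any index but the last repeats an index, and raising the last one gives `p_{2n+1}`; the
border accounts for the term with `z` (`hasPartial_pfaffian_bordered`).

For the Lax equations, differentiate `Q m Qᵀ = J` (`piK_conj_eq`). The result says that `(L^k + Q'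
Q⁻¹) J` is symmetric, so `L^k + Q' Q⁻¹` lies in `𝐧`, while `Q' Q⁻¹` lies in `𝐤`; hence `Q' Q⁻¹ =
-π_𝐤 L^k`. Differentiating `L = Q Λ Q⁻¹` gives the commutator. The diagonal of `Q` consists of the
inverse roots of `h̃`, so the diagonal blocks of the same identity give the equation for `h̃`. -/

/-! ### Pfaffians -/

/-- The position `2r` of the pair `r`. -/
def evenPos {n : ℕ} (r : Fin n) : Fin (2 * n) := ⟨2 * r, by omega⟩

/-- The position `2r + 1` of the pair `r`. -/
def oddPos {n : ℕ} (r : Fin n) : Fin (2 * n) := ⟨2 * r + 1, by omega⟩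

/-- The pair to which a position belongs. -/
def pairOf {n : ℕ} (p : Fin (2 * n)) : Fin n := ⟨p / 2, by omega⟩

theorem eq_evenPos_or_oddPos {n : ℕ} (p : Fin (2 * n)) :
    p = evenPos (pairOf p) ∨ p = oddPos (pairOf p) := by
  simp only [evenPos, oddPos, pairOf, Fin.ext_iff]; omega

theorem evenPos_ne_oddPos {n : ℕ} (r s : Fin n) : evenPos r ≠ oddPos s := by
  simp only [evenPos, oddPos, ne_eq, Fin.ext_iff]; omega

theorem evenPos_inj {n : ℕ} {r s : Fin n} : evenPos r = evenPos s ↔ r = s := by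
  simp only [evenPos, Fin.ext_iff]; omega

theorem oddPos_inj {n : ℕ} {r s : Fin n} : oddPos r = oddPos s ↔ r = s := by
  simp only [oddPos, Fin.ext_iff]; omega

theorem pairOf_evenPos {n : ℕ} (r : Fin n) : pairOf (evenPos r) = r := by
  simp [pairOf, evenPos]

theorem pairOf_oddPos {n : ℕ} (r : Fin n) : pairOf (oddPos r) = r := by
  simp only [pairOf, oddPos, Fin.ext_iff]; omega

theorem sum_positions {M : Type*} [AddCommMonoid M] {n : ℕ} (F : Fin (2 * n) → M) :
    ∑ p, F p = ∑ r : Fin n, (F (evenPos r) + F (oddPos r)) := by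
  rw [← Finset.sum_fiberwise (s := Finset.univ) (g := pairOf) (f := F)]
  refine Finset.sum_congr rfl fun r _ => ?_
  rw [← Finset.sum_pair (evenPos_ne_oddPos r r)]
  refine Finset.sum_congr ?_ fun _ _ => rfl
  ext p
  simp only [Finset.mem_filter, Finset.mem_univ, true_and, Finset.mem_insert,
    Finset.mem_singleton]
  constructor
  · rintro rfl; exact eq_evenPos_or_oddPos p
  · rintro (rfl | rfl)
    · exact pairOf_evenPos r
    · exact pairOf_oddPos r

theorem pfaffian_def {R : Type*} [CommRing R] [Algebra ℚ R] (n : ℕ)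
    (A : Matrix (Fin (2 * n)) (Fin (2 * n)) R) :
    pfaffian n A = (1 / (2 ^ n * (n.factorial : ℚ))) •
      ∑ σ : Equiv.Perm (Fin (2 * n)), ((Equiv.Perm.sign σ : ℤ) : R) *
        ∏ r : Fin n, A (σ (evenPos r)) (σ (oddPos r)) := rfl

/-- Left translation of the summation variable by `π⁻¹` absorbs `π` and leaves its sign;
skew-symmetry plays no role. -/
theorem pfaffian_submatrix {n : ℕ} (A : Matrix (Fin (2 * n)) (Fin (2 * n)) ℂ)
    (π : Equiv.Perm (Fin (2 * n))) :
    pfaffian n (A.submatrix π π) = ((Equiv.Perm.sign π : ℤ) : ℂ) * pfaffian n A := by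
  rw [pfaffian_def, pfaffian_def, mul_smul_comm]
  congr 1
  rw [Finset.mul_sum, ← Equiv.sum_comp (Equiv.mulLeft π⁻¹)]
  refine Finset.sum_congr rfl fun σ _ => ?_
  simp only [Equiv.coe_mulLeft, Equiv.Perm.sign_mul, Equiv.Perm.sign_symm, Equiv.Perm.inv_def,
    Matrix.submatrix_apply,
    Equiv.Perm.mul_apply, Equiv.apply_symm_apply]
  push_cast
  ring

theorem pfaffian_submatrix_swap {n : ℕ} (A : Matrix (Fin (2 * n)) (Fin (2 * n)) ℂ)
    {x y : Fin (2 * n)} (hxy : x ≠ y) :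
    pfaffian n (A.submatrix (Equiv.swap x y) (Equiv.swap x y)) = -pfaffian n A := by
  rw [pfaffian_submatrix, Equiv.Perm.sign_swap hxy]; simp

/-- Exchanging the two positions leaves the matrix unchanged but reverses the sign of its Pfaffian.
-/
theorem pfaffian_eq_zero_of_repeat {n : ℕ} {ι : Type*} (B : ι → ι → ℂ) (f : Fin (2 * n) → ι)
    {x y : Fin (2 * n)} (hxy : x ≠ y) (h : f x = f y) :
    pfaffian n (Matrix.of fun a b => B (f a) (f b)) = 0 := by
  have hf : ∀ a, f (Equiv.swap x y a) = f a := by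
    intro a
    rw [Equiv.swap_apply_def]
    split_ifs with h1 h2
    · rw [h1, h]
    · rw [h2, h]
    · rfl
  have := pfaffian_submatrix_swap (Matrix.of fun a b => B (f a) (f b)) hxy
  have h2 : (Matrix.of fun a b => B (f a) (f b)).submatrix (Equiv.swap x y) (Equiv.swap x y)
      = Matrix.of fun a b => B (f a) (f b) := by
    ext a b; simp [hf]
  rw [h2] at this
  exact self_eq_neg.mp this

/-- The matrix `(m_{ab})_{0 ≤ a, b ≤ 2n+1}` with column `c` replaced by `v`, row `c` by `-v`. -/
def borderedBy (m : SMat) (n c : ℕ) (v : ℕ → ℂ) :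
    Matrix (Fin (2 * (n + 1))) (Fin (2 * (n + 1))) ℂ :=
  Matrix.of fun a b =>
    if (a : ℕ) = c then (if (b : ℕ) = c then 0 else -v b)
    else if (b : ℕ) = c then v a else m a b

/-- In the term of `σ`, the index `c` occurs in exactly one pair, and its companion there is not
`c`. The term is thus a scalar times `±X ^ a`, and `φ` acts on that one factor. -/
theorem map_pfaffian_bordered (m : SMat) (n : ℕ) (c : Fin (2 * (n + 1))) (φ : ℂ[X] →ₗ[ℂ] ℂ) :
    φ (pfaffian (n + 1) (bordered m n c))
      = pfaffian (n + 1) (borderedBy m n c fun a => φ (X ^ a)) := by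
  rw [pfaffian_def, pfaffian_def, map_rat_smul, map_sum]
  congr 1
  refine Finset.sum_congr rfl fun σ _ => ?_
  rw [← zsmul_eq_mul, ← zsmul_eq_mul, map_zsmul]
  congr 1
  rw [← Finset.mul_prod_erase _ _ (Finset.mem_univ (pairOf (σ.symm c))),
    ← Finset.mul_prod_erase _ _ (Finset.mem_univ (pairOf (σ.symm c)))]
  have hne : ∀ r ∈ Finset.univ.erase (pairOf (σ.symm c)),
      (σ (evenPos r) : ℕ) ≠ c ∧ (σ (oddPos r) : ℕ) ≠ c := by
    intro r hr
    have hr' := Finset.ne_of_mem_erase hr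
    refine ⟨fun h => hr' ?_, fun h => hr' ?_⟩
    · rw [← Fin.ext h, Equiv.symm_apply_apply, pairOf_evenPos]
    · rw [← Fin.ext h, Equiv.symm_apply_apply, pairOf_oddPos]
  have e1 : ∏ r ∈ Finset.univ.erase (pairOf (σ.symm c)),
      bordered m n c (σ (evenPos r)) (σ (oddPos r))
      = C (∏ r ∈ Finset.univ.erase (pairOf (σ.symm c)), m (σ (evenPos r)) (σ (oddPos r))) := by
    rw [map_prod]
    refine Finset.prod_congr rfl fun r hr => ?_
    simp [bordered, hne r hr]
  have e2 : ∏ r ∈ Finset.univ.erase (pairOf (σ.symm c)),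
      borderedBy m n c (fun a => φ (X ^ a)) (σ (evenPos r)) (σ (oddPos r))
      = ∏ r ∈ Finset.univ.erase (pairOf (σ.symm c)), m (σ (evenPos r)) (σ (oddPos r)) := by
    refine Finset.prod_congr rfl fun r hr => ?_
    simp [borderedBy, hne r hr]
  rw [e1, e2, mul_comm _ (C _), ← smul_eq_C_mul, map_smul, smul_eq_mul, mul_comm]
  congr 1
  rcases eq_evenPos_or_oddPos (σ.symm c) with h | h
  · have h1 : σ (evenPos (pairOf (σ.symm c))) = c := by rw [← h, Equiv.apply_symm_apply]
    have h2 : (σ (oddPos (pairOf (σ.symm c))) : ℕ) ≠ c := by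
      rw [ne_eq, ← Fin.ext_iff, ← h1, σ.injective.eq_iff]
      exact (evenPos_ne_oddPos _ _).symm
    simp [bordered, borderedBy, h1, h2]
  · have h1 : σ (oddPos (pairOf (σ.symm c))) = c := by rw [← h, Equiv.apply_symm_apply]
    have h2 : (σ (evenPos (pairOf (σ.symm c))) : ℕ) ≠ c := by
      rw [ne_eq, ← Fin.ext_iff, ← h1, σ.injective.eq_iff]
      exact evenPos_ne_oddPos _ _
    simp [bordered, borderedBy, h1, h2]

/-- The Pfaffian as a derivation: if the derivative of `A a b` is the sum of a contribution of the
index `a` and one of the index `b`, then `pf A` is differentiated index by index. -/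
theorem hasDerivWithinAt_pfaffian {n : ℕ} {A : ℂ → Matrix (Fin (2 * n)) (Fin (2 * n)) ℂ}
    {G : Fin (2 * n) → Matrix (Fin (2 * n)) (Fin (2 * n)) ℂ} {S : Set ℂ} {x : ℂ}
    (hA : ∀ a b, HasDerivWithinAt (fun s => A s a b) (G a a b + G b a b) S x)
    (hG : ∀ c a b, a ≠ c → b ≠ c → G c a b = A x a b) :
    HasDerivWithinAt (fun s => pfaffian n (A s)) (∑ c, pfaffian n (G c)) S x := by
  have key : ∀ σ : Equiv.Perm (Fin (2 * n)),
      HasDerivWithinAt (fun s => ∏ r : Fin n, A s (σ (evenPos r)) (σ (oddPos r)))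
        (∑ c, ∏ r : Fin n, G c (σ (evenPos r)) (σ (oddPos r))) S x := by
    intro σ
    have h := HasDerivWithinAt.fun_finsetProd (u := (Finset.univ : Finset (Fin n)))
      (f := fun r s => A s (σ (evenPos r)) (σ (oddPos r)))
      (fun r _ => hA (σ (evenPos r)) (σ (oddPos r)))
    refine h.congr_deriv ?_
    -- The Leibniz rule gives one term per pair, the sum over `c` one per index. Indexing the latter
    -- by positions groups it into pairs, each with a contribution from both of its places.
    rw [← Equiv.sum_comp σ, sum_positions]
    refine Finset.sum_congr rfl fun r _ => ?_
    rw [← Finset.mul_prod_erase _ _ (Finset.mem_univ r),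
      ← Finset.mul_prod_erase _ _ (Finset.mem_univ r), smul_eq_mul, mul_add, mul_comm,
      mul_comm _ (G (σ (oddPos r)) _ _)]
    congr 2
    · refine Finset.prod_congr rfl fun r' hr' => ?_
      have hr := Finset.ne_of_mem_erase hr'
      rw [hG]
      · rw [σ.injective.ne_iff]; exact fun h => hr (evenPos_inj.mp h)
      · rw [σ.injective.ne_iff]; exact (evenPos_ne_oddPos _ _).symm
    · refine Finset.prod_congr rfl fun r' hr' => ?_
      have hr := Finset.ne_of_mem_erase hr'
      rw [hG]
      · rw [σ.injective.ne_iff]; exact evenPos_ne_oddPos _ _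
      · rw [σ.injective.ne_iff]; exact fun h => hr (oddPos_inj.mp h)
  simp only [pfaffian_def]
  rw [← Finset.smul_sum, Finset.sum_comm]
  simp only [← Finset.mul_sum, Rat.smul_def]
  exact (HasDerivWithinAt.fun_sum fun σ _ => (key σ).const_mul _).const_mul _

theorem DifferentiableWithinAt.pfaffian {n : ℕ}
    {A : ℂ → Matrix (Fin (2 * n)) (Fin (2 * n)) ℂ} {S : Set ℂ} {x : ℂ}
    (hA : ∀ a b, DifferentiableWithinAt ℂ (fun s => A s a b) S x) :
    DifferentiableWithinAt ℂ (fun s => _root_.pfaffian n (A s)) S x := by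
  simp only [pfaffian_def, Rat.smul_def]
  refine DifferentiableWithinAt.const_mul (DifferentiableWithinAt.fun_sum fun σ _ =>
    DifferentiableWithinAt.const_mul (DifferentiableWithinAt.fun_finsetProd fun r _ => hA _ _) _) _

/-! ### Expansion of a Pfaffian along its last column. -/

/-- The term of a permutation in the Pfaffian. -/
def pfTerm {n : ℕ} (A : Matrix (Fin (2 * n)) (Fin (2 * n)) ℂ) (σ : Equiv.Perm (Fin (2 * n))) : ℂ :=
  ((Equiv.Perm.sign σ : ℤ) : ℂ) * ∏ r : Fin n, A (σ (evenPos r)) (σ (oddPos r))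

/-- The sign of the transposition cancels the sign from skew-symmetry of the one factor it reverses.
-/
theorem pfTerm_flip {n : ℕ} (A : Matrix (Fin (2 * n)) (Fin (2 * n)) ℂ)
    (hA : ∀ a b, A a b = -A b a) (s : Fin n) (σ : Equiv.Perm (Fin (2 * n))) :
    pfTerm A (σ * Equiv.swap (evenPos s) (oddPos s)) = pfTerm A σ := by
  have hprod : ∏ r : Fin n, A ((σ * Equiv.swap (evenPos s) (oddPos s)) (evenPos r))
      ((σ * Equiv.swap (evenPos s) (oddPos s)) (oddPos r))
      = -∏ r : Fin n, A (σ (evenPos r)) (σ (oddPos r)) := by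
    rw [← Finset.mul_prod_erase _ _ (Finset.mem_univ s),
      ← Finset.mul_prod_erase _ _ (Finset.mem_univ s), ← neg_mul]
    congr 1
    · simp only [Equiv.Perm.mul_apply, Equiv.swap_apply_left, Equiv.swap_apply_right]
      exact hA _ _
    · refine Finset.prod_congr rfl fun r hr => ?_
      have hr' := Finset.ne_of_mem_erase hr
      simp only [Equiv.Perm.mul_apply]
      rw [Equiv.swap_apply_of_ne_of_ne (fun h => hr' (evenPos_inj.mp h)) (evenPos_ne_oddPos _ _),
        Equiv.swap_apply_of_ne_of_ne (evenPos_ne_oddPos _ _).symm (fun h => hr' (oddPos_inj.mp h))]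
  rw [pfTerm, hprod, pfTerm]
  simp [Equiv.Perm.sign_swap (evenPos_ne_oddPos s s)]

/-- Exchanging two whole pairs is an even permutation that only reorders the factors. -/
theorem pfTerm_pairSwap {n : ℕ} (A : Matrix (Fin (2 * n)) (Fin (2 * n)) ℂ)
    {s t : Fin n} (hst : s ≠ t) (σ : Equiv.Perm (Fin (2 * n))) :
    pfTerm A (σ * (Equiv.swap (evenPos s) (evenPos t) * Equiv.swap (oddPos s) (oddPos t)))
      = pfTerm A σ := by
  have h1 : ∀ r, (Equiv.swap (evenPos s) (evenPos t) * Equiv.swap (oddPos s) (oddPos t))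
      (evenPos r) = evenPos (Equiv.swap s t r) := by
    intro r
    rw [Equiv.Perm.mul_apply, Equiv.swap_apply_of_ne_of_ne (evenPos_ne_oddPos _ _)
      (evenPos_ne_oddPos _ _), Equiv.swap_apply_def, Equiv.swap_apply_def]
    simp only [evenPos_inj]
    split_ifs <;> rfl
  have h2 : ∀ r, (Equiv.swap (evenPos s) (evenPos t) * Equiv.swap (oddPos s) (oddPos t))
      (oddPos r) = oddPos (Equiv.swap s t r) := by
    intro r
    have : Equiv.swap (oddPos s) (oddPos t) (oddPos r) = oddPos (Equiv.swap s t r) := by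
      rw [Equiv.swap_apply_def, Equiv.swap_apply_def]
      simp only [oddPos_inj]
      split_ifs <;> rfl
    rw [Equiv.Perm.mul_apply, this, Equiv.swap_apply_of_ne_of_ne (evenPos_ne_oddPos _ _).symm
      (evenPos_ne_oddPos _ _).symm]
  have hprod : ∏ r : Fin n,
      A ((σ * (Equiv.swap (evenPos s) (evenPos t) * Equiv.swap (oddPos s) (oddPos t))) (evenPos r))
      ((σ * (Equiv.swap (evenPos s) (evenPos t) * Equiv.swap (oddPos s) (oddPos t))) (oddPos r))
      = ∏ r : Fin n, A (σ (evenPos r)) (σ (oddPos r)) := by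
    rw [← Equiv.prod_comp (Equiv.swap s t) (fun r => A (σ (evenPos r)) (σ (oddPos r)))]
    refine Finset.prod_congr rfl fun r _ => ?_
    rw [Equiv.Perm.mul_apply σ, Equiv.Perm.mul_apply σ, h1, h2]
  rw [pfTerm, hprod, pfTerm]
  simp [Equiv.Perm.sign_swap (fun h => hst (evenPos_inj.mp h)),
    Equiv.Perm.sign_swap (fun h => hst (oddPos_inj.mp h))]

/-- The term of a permutation can be transported so that a given position becomes the last. -/
theorem exists_pfTerm_transport {n : ℕ} (A : Matrix (Fin (2 * (n + 1))) (Fin (2 * (n + 1))) ℂ)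
    (hA : ∀ a b, A a b = -A b a) (p : Fin (2 * (n + 1))) :
    ∃ g : Equiv.Perm (Fin (2 * (n + 1))), g (oddPos (Fin.last n)) = p ∧
      ∀ σ, pfTerm A (σ * g) = pfTerm A σ := by
  have hodd : ∀ r : Fin (n + 1), ∃ g : Equiv.Perm (Fin (2 * (n + 1))),
      g (oddPos (Fin.last n)) = oddPos r ∧ ∀ σ, pfTerm A (σ * g) = pfTerm A σ := by
    intro r
    by_cases hr : r = Fin.last n
    · exact ⟨1, by simp [hr], by simp⟩
    · refine ⟨_, ?_, pfTerm_pairSwap A hr⟩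
      rw [Equiv.Perm.mul_apply, Equiv.swap_apply_right, Equiv.swap_apply_of_ne_of_ne
        (evenPos_ne_oddPos _ _).symm (evenPos_ne_oddPos _ _).symm]
  obtain ⟨g, hg1, hg2⟩ := hodd (pairOf p)
  rcases eq_evenPos_or_oddPos p with h | h
  · refine ⟨Equiv.swap (evenPos (pairOf p)) (oddPos (pairOf p)) * g, ?_, fun σ => ?_⟩
    · rw [Equiv.Perm.mul_apply, hg1, Equiv.swap_apply_right, ← h]
    · rw [← mul_assoc, hg2, pfTerm_flip A hA]
  · exact ⟨g, by rw [hg1, ← h], hg2⟩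

/-- Every permutation takes the last value at exactly one of the `2(n+1)` positions, and by
transport all positions contribute equally. -/
theorem sum_pfTerm_eq {n : ℕ} (A : Matrix (Fin (2 * (n + 1))) (Fin (2 * (n + 1))) ℂ)
    (hA : ∀ a b, A a b = -A b a) :
    ∑ σ, pfTerm A σ = (2 * (n + 1) : ℂ) *
      ∑ σ : Equiv.Perm (Fin (2 * (n + 1))),
        if σ (oddPos (Fin.last n)) = oddPos (Fin.last n) then pfTerm A σ else 0 := by
  have h1 : ∀ σ : Equiv.Perm (Fin (2 * (n + 1))), pfTerm A σ
      = ∑ p, if σ p = oddPos (Fin.last n) then pfTerm A σ else 0 := by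
    intro σ
    rw [Finset.sum_eq_single (σ.symm (oddPos (Fin.last n)))]
    · simp
    · intro p _ hp
      rw [if_neg]
      intro h
      apply hp
      rw [← h, Equiv.symm_apply_apply]
    · simp
  rw [Finset.sum_congr rfl fun σ _ => h1 σ, Finset.sum_comm]
  have h2 : ∀ p, (∑ σ : Equiv.Perm (Fin (2 * (n + 1))),
      if σ p = oddPos (Fin.last n) then pfTerm A σ else 0)
      = ∑ σ : Equiv.Perm (Fin (2 * (n + 1))),
        if σ (oddPos (Fin.last n)) = oddPos (Fin.last n) then pfTerm A σ else 0 := by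
    intro p
    obtain ⟨g, hg1, hg2⟩ := exists_pfTerm_transport A hA p
    rw [← Equiv.sum_comp (Equiv.mulRight g) (fun σ : Equiv.Perm (Fin (2 * (n + 1))) =>
        if σ (oddPos (Fin.last n)) = oddPos (Fin.last n) then pfTerm A σ else 0)]
    refine Finset.sum_congr rfl fun σ _ => ?_
    simp [hg1, hg2]
  rw [Finset.sum_congr rfl fun p _ => h2 p, Finset.sum_const]
  simp

/-- Expansion of a Pfaffian whose last row has a single nonzero entry, in the last place but one. -/
theorem pfaffian_last {n : ℕ} (A : Matrix (Fin (2 * (n + 1))) (Fin (2 * (n + 1))) ℂ)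
    (hA : ∀ a b, A a b = -A b a) (h0 : ∀ a, a ≠ evenPos (Fin.last n) →
      A a (oddPos (Fin.last n)) = 0) :
    pfaffian (n + 1) A = A (evenPos (Fin.last n)) (oddPos (Fin.last n)) *
      pfaffian n (A.submatrix (Fin.castLE (by omega)) (Fin.castLE (by omega))) := by
  set B := A.submatrix (Fin.castLE (by omega : 2 * n ≤ 2 * (n + 1)))
    (Fin.castLE (by omega : 2 * n ≤ 2 * (n + 1))) with hB
  set w := A (evenPos (Fin.last n)) (oddPos (Fin.last n)) with hw
  let P : Fin (2 * (n + 1)) → Prop := fun x => (x : ℕ) < 2 * n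
  let e : Fin (2 * n) ≃ Subtype P :=
    { toFun := fun x => ⟨Fin.castLE (by omega) x, x.2⟩
      invFun := fun x => ⟨x.1, x.2⟩
      left_inv := fun x => rfl
      right_inv := fun x => rfl }
  have hsum : (∑ σ : Equiv.Perm (Fin (2 * (n + 1))),
      if σ (oddPos (Fin.last n)) = oddPos (Fin.last n) then pfTerm A σ else 0)
      = w * ∑ σ, pfTerm B σ := by
    have hstep : (∑ σ : Equiv.Perm (Fin (2 * (n + 1))),
        if σ (oddPos (Fin.last n)) = oddPos (Fin.last n) then pfTerm A σ else 0)
        = ∑ σ : Equiv.Perm (Fin (2 * (n + 1))) with ∀ a, ¬ P a → σ a = a, pfTerm A σ := by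
      rw [Finset.sum_filter]
      refine Finset.sum_congr rfl fun σ _ => ?_
      by_cases hc : ∀ a, ¬ P a → σ a = a
      · rw [if_pos hc, if_pos (hc _ (by simp [P, oddPos]))]
      · rw [if_neg hc]
        split_ifs with h
        -- Here the last place is fixed but not its companion, so the factor of the last pair
        -- vanishes by `h0`.
        · rw [pfTerm, Finset.prod_eq_zero (Finset.mem_univ (Fin.last n)), mul_zero]
          rw [h]
          refine h0 _ fun h' => hc fun a ha => ?_
          have : a = evenPos (Fin.last n) ∨ a = oddPos (Fin.last n) := by
            simp only [P] at ha
            simp only [evenPos, oddPos, Fin.ext_iff, Fin.val_last]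
            omega
          rcases this with rfl | rfl
          · exact h'
          · exact h
        · rfl
    rw [hstep, Finset.sum_subtype (p := fun σ : Equiv.Perm (Fin (2 * (n + 1))) =>
      ∀ a, ¬ P a → σ a = a) _ (by simp), ← Equiv.sum_comp
      (e.permCongr.trans (Equiv.Perm.subtypeEquivSubtypePerm P)), Finset.mul_sum]
    refine Finset.sum_congr rfl fun σ _ => ?_
    have hin : ∀ x : Fin (2 * n), (Equiv.Perm.ofSubtype (e.permCongr σ))
        (Fin.castLE (by omega) x) = Fin.castLE (by omega) (σ x) := by
      intro x
      rw [Equiv.Perm.ofSubtype_apply_of_mem _ (show P (Fin.castLE (by omega) x) from x.2)]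
      rfl
    have hout : ∀ x, ¬ P x → (Equiv.Perm.ofSubtype (e.permCongr σ)) x = x := fun x hx =>
      Equiv.Perm.ofSubtype_apply_of_not_mem _ hx
    rw [Equiv.trans_apply, Equiv.Perm.subtypeEquivSubtypePerm_apply_coe, pfTerm, pfTerm,
      Equiv.Perm.sign_ofSubtype, Equiv.Perm.sign_permCongr, Fin.prod_univ_castSucc,
      hout _ (by simp [P, evenPos]), hout _ (by simp [P, oddPos]), ← hw, ← mul_assoc, mul_comm w]
    congr 2
    refine Finset.prod_congr rfl fun r _ => ?_
    have h1 : (evenPos r.castSucc : Fin (2 * (n + 1))) = Fin.castLE (by omega) (evenPos r) := rfl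
    have h2 : (oddPos r.castSucc : Fin (2 * (n + 1))) = Fin.castLE (by omega) (oddPos r) := rfl
    rw [h1, h2, hin, hin]
    rfl
  have e1 : pfaffian (n + 1) A = (1 / (2 ^ (n + 1) * ((n + 1).factorial : ℚ))) •
      ∑ σ, pfTerm A σ := rfl
  have e2 : pfaffian n B = (1 / (2 ^ n * (n.factorial : ℚ))) • ∑ σ, pfTerm B σ := rfl
  -- The factor `2(n+1)` is exactly the ratio of the two normalizing constants.
  rw [e1, e2, sum_pfTerm_eq A hA, hsum, Rat.smul_def, Rat.smul_def]
  have hn : (n.factorial : ℂ) ≠ 0 := by exact_mod_cast n.factorial_ne_zero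
  have hn1 : (n + 1 : ℂ) ≠ 0 := by exact_mod_cast n.succ_ne_zero
  push_cast [Nat.factorial_succ, pow_succ]
  field_simp

/-! ### Products of semi-infinite matrices -/

/-- Every row has finitely many nonzero entries. -/
def RowFin (A : SMat) : Prop := ∀ i, ∃ N, ∀ j, N ≤ j → A i j = 0

theorem smatMul_apply_of_row {A : SMat} {i N : ℕ} (h : ∀ k, N ≤ k → A i k = 0) (B : SMat) (j : ℕ) :
    (A ⋆ B) i j = ∑ k ∈ Finset.range N, A i k * B k j := by
  simp only [smatMul, Matrix.of_apply]
  refine finsum_eq_sum_of_support_subset _ fun k hk => ?_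
  rw [Finset.coe_range, Set.mem_Iio]
  by_contra hN
  exact hk (by simp [h k (not_lt.mp hN)])

theorem smatMul_transpose (A B : SMat) :
    (A ⋆ B).transpose = B.transpose ⋆ A.transpose := by
  ext i j
  simp only [smatMul, Matrix.of_apply, Matrix.transpose_apply, mul_comm]

theorem RowFin.mul {A B : SMat} (hA : RowFin A) (hB : RowFin B) : RowFin (A ⋆ B) := by
  intro i
  obtain ⟨N, hN⟩ := hA i
  choose M hM using hB
  refine ⟨(Finset.range N).sup M, fun j hj => ?_⟩
  rw [smatMul_apply_of_row hN]
  refine Finset.sum_eq_zero fun k hk => ?_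
  rw [hM k j ((Finset.le_sup hk).trans hj), mul_zero]

/-- A `finsum` with infinite support is zero by convention, so associativity needs finiteness. It is
proved in three forms, according to which factors have finite rows or columns. -/
theorem smatMul_assoc {A B : SMat} (hA : RowFin A) (hB : RowFin B) (C : SMat) :
    A ⋆ B ⋆ C = A ⋆ (B ⋆ C) := by
  ext i j
  obtain ⟨N, hN⟩ := hA i
  choose M hM using hB
  have h1 : ∀ l, (Finset.range N).sup M ≤ l → (A ⋆ B) i l = 0 := by
    intro l hl
    rw [smatMul_apply_of_row hN]
    refine Finset.sum_eq_zero fun k hk => ?_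
    rw [hM k l ((Finset.le_sup hk).trans hl), mul_zero]
  have h2 : ∀ k ∈ Finset.range N, (B ⋆ C) k j
      = ∑ l ∈ Finset.range ((Finset.range N).sup M), B k l * C l j := fun k hk =>
    smatMul_apply_of_row (fun l hl => hM k l ((Finset.le_sup hk).trans hl)) _ _
  have h3 : (A ⋆ (B ⋆ C)) i j = ∑ k ∈ Finset.range N,
      A i k * ∑ l ∈ Finset.range ((Finset.range N).sup M), B k l * C l j := by
    rw [smatMul_apply_of_row hN]
    exact Finset.sum_congr rfl fun k hk => by rw [h2 k hk]
  rw [smatMul_apply_of_row h1, h3]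
  simp_rw [smatMul_apply_of_row hN, Finset.sum_mul, Finset.mul_sum]
  rw [Finset.sum_comm]
  simp_rw [mul_assoc]

/-- The middle factor is arbitrary: this is the form needed for `Q m Qᵀ`, where `m` may be a full
matrix. -/
theorem smatMul_assoc_of_col {A C : SMat} (hA : RowFin A) (hC : RowFin C.transpose) (B : SMat) :
    A ⋆ B ⋆ C = A ⋆ (B ⋆ C) := by
  ext i j
  obtain ⟨N, hN⟩ := hA i
  obtain ⟨M, hM⟩ := hC j
  have hcol : ∀ X : SMat, (X ⋆ C) = (C.transpose ⋆ X.transpose).transpose := fun X => by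
    rw [smatMul_transpose]; rfl
  rw [smatMul_apply_of_row hN]
  simp only [hcol, Matrix.transpose_apply, smatMul_apply_of_row hM, smatMul_apply_of_row hN,
    Finset.mul_sum]
  rw [Finset.sum_comm]
  refine Finset.sum_congr rfl fun k _ => Finset.sum_congr rfl fun l _ => ?_
  ring

theorem smatMul_assoc_of_col_col {B C : SMat} (hB : RowFin B.transpose) (hC : RowFin C.transpose)
    (A : SMat) : A ⋆ B ⋆ C = A ⋆ (B ⋆ C) := by
  apply Matrix.transpose_injective
  simp only [smatMul_transpose]
  exact (smatMul_assoc hC hB _).symm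

theorem smatMul_add {A : SMat} (hA : RowFin A) (B C : SMat) : A ⋆ (B + C) = A ⋆ B + A ⋆ C := by
  ext i j
  obtain ⟨N, hN⟩ := hA i
  simp only [Matrix.add_apply, smatMul_apply_of_row hN, mul_add, Finset.sum_add_distrib]

theorem add_smatMul_of_col {C : SMat} (hC : RowFin C.transpose) (A B : SMat) :
    (A + B) ⋆ C = A ⋆ C + B ⋆ C := by
  apply Matrix.transpose_injective
  simp only [smatMul_transpose, Matrix.transpose_add]
  exact smatMul_add hC _ _

theorem smatMul_neg (A B : SMat) : A ⋆ (-B) = -(A ⋆ B) := by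
  ext i j
  simp [smatMul, finsum_neg_distrib]

theorem neg_smatMul (A B : SMat) : -A ⋆ B = -(A ⋆ B) := by
  ext i j
  simp [smatMul, finsum_neg_distrib]

theorem diagonal_smatMul (d : ℕ → ℂ) (A : SMat) (i j : ℕ) :
    (Matrix.diagonal d ⋆ A) i j = d i * A i j := by
  simp only [smatMul, Matrix.of_apply]
  rw [finsum_eq_single _ i]
  · simp
  · intro k hk
    simp [Matrix.diagonal_apply_ne' _ hk]

theorem one_smatMul (A : SMat) : (1 : SMat) ⋆ A = A := by
  ext i j
  rw [← Matrix.diagonal_one, diagonal_smatMul, one_mul]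

theorem smatMul_one (A : SMat) : A ⋆ 1 = A := by
  apply Matrix.transpose_injective
  rw [smatMul_transpose, Matrix.transpose_one, one_smatMul]

/-! ### The matrix `J` -/

theorem partner_div (i : ℕ) : partner i / 2 = i / 2 := by
  simp only [partner]; split_ifs <;> omega

theorem partner_partner (i : ℕ) : partner (partner i) = i := by
  simp only [partner]; split_ifs <;> omega

theorem rowSign_mul_self (i : ℕ) : rowSign i * rowSign i = 1 := by
  simp only [rowSign]; split_ifs <;> simp

theorem rowSign_partner (i : ℕ) : rowSign (partner i) = -rowSign i := by
  simp only [rowSign, partner]; split_ifs <;> first | omega | simp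

theorem Jmat_smatMul (A : SMat) (i j : ℕ) : (Jmat ⋆ A) i j = rowSign i * A (partner i) j := by
  simp only [smatMul, Matrix.of_apply]
  rw [finsum_eq_single _ (partner i)]
  · simp [Jmat_apply]
  · intro k hk
    simp [Jmat_apply, hk]

theorem Jmat_transpose : Jmat.transpose = -Jmat := by
  ext i j
  simp only [Matrix.transpose_apply, Matrix.neg_apply, Jmat, Matrix.of_apply]
  split_ifs <;> first | omega | simp

theorem smatMul_Jmat (A : SMat) (i j : ℕ) :
    (A ⋆ Jmat) i j = -(rowSign j * A i (partner j)) := by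
  have h : A ⋆ Jmat = (-(Jmat ⋆ A.transpose)).transpose := by
    rw [← neg_neg (A ⋆ Jmat), ← smatMul_neg, ← Jmat_transpose, Matrix.transpose_neg,
      smatMul_transpose]
    rfl
  rw [h, Matrix.transpose_apply, Matrix.neg_apply, Jmat_smatMul, Matrix.transpose_apply]

theorem Jmat_smatMul_Jmat : Jmat ⋆ Jmat = -1 := by
  ext i j
  rw [Jmat_smatMul, Jmat_apply, partner_partner, rowSign_partner, Matrix.neg_apply,
    Matrix.one_apply]
  simp only [eq_comm (a := j)]
  split_ifs
  · rw [mul_neg, rowSign_mul_self]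
  · simp

theorem rowFin_Jmat : RowFin Jmat := fun i =>
  ⟨i + 2, fun j hj => by
    rw [Jmat_apply, if_neg]
    have := partner_div i
    rintro rfl
    omega⟩

theorem rowFin_Jmat_transpose : RowFin Jmat.transpose := fun i =>
  (rowFin_Jmat i).imp fun N hN j hj => by
    rw [Jmat_transpose, Matrix.neg_apply, hN j hj, neg_zero]

/-- Since `Jᵀ = -J`, symmetry of `W J` means `-J Wᵀ = W J`; multiply by `J` on the right and use `J²
= -1`. -/
theorem isN_of_symm {W : SMat} (h : (W ⋆ Jmat).transpose = W ⋆ Jmat) : IsN W := by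
  ext i j
  have := congrFun (congrFun h i) (partner j)
  rw [Matrix.transpose_apply, smatMul_Jmat, smatMul_Jmat, partner_partner, rowSign_partner] at this
  rw [calJ_apply]
  linear_combination rowSign j * this + W i j * rowSign_mul_self j

/-! ### Powers of the shift -/

theorem spow_shiftMat_apply (n i j : ℕ) :
    spow shiftMat n i j = if j = i + n then 1 else 0 := by
  induction n generalizing i j with
  | zero => simp [spow, Matrix.one_apply, eq_comm]
  | succ n ih =>
    rw [spow, smatMul_apply_of_row (N := i + n + 1) (fun k hk => by rw [ih, if_neg]; omega),
      Finset.sum_eq_single (i + n)]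
    · rw [ih]; simp [shiftMat, add_assoc]
    · intro k _ hk; rw [ih, if_neg hk, zero_mul]
    · intro h; simp at h

theorem spow_shiftMat_transpose (n : ℕ) :
    spow shiftMat.transpose n = (spow shiftMat n).transpose := by
  induction n with
  | zero => simp [spow]
  | succ n ih =>
    ext i j
    rw [spow, ih, Matrix.transpose_apply, spow_shiftMat_apply, smatMul_apply_of_row (N := i + 1)
      (fun k hk => by rw [Matrix.transpose_apply, spow_shiftMat_apply, if_neg]; omega)]
    have hsh : ∀ k, shiftMat j k = if k = j + 1 then 1 else 0 := fun k => rfl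
    simp only [Matrix.transpose_apply, spow_shiftMat_apply, hsh]
    split_ifs with h
    · rw [Finset.sum_eq_single (j + 1)]
      · rw [if_pos (by omega), if_pos rfl, one_mul]
      · intro k _ hk; rw [if_neg hk, mul_zero]
      · intro h'; simp only [Finset.mem_range] at h'; omega
    · refine Finset.sum_eq_zero fun k _ => ?_
      by_cases hk : k = j + 1
      · rw [if_neg (by omega), zero_mul]
      · rw [if_neg hk, mul_zero]

theorem rowFin_spow_shiftMat (n : ℕ) : RowFin (spow shiftMat n) := fun i =>
  ⟨i + n + 1, fun j hj => by rw [spow_shiftMat_apply, if_neg]; omega⟩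

theorem spow_shiftMat_one : spow shiftMat 1 = shiftMat := by
  rw [spow, spow, one_smatMul]

theorem spow_conj {Q R X : SMat} (hQ : RowFin Q) (hR : RowFin R) (hX : RowFin X)
    (hX' : ∀ n, RowFin (spow X n)) (hQR : Q ⋆ R = 1) (hRQ : R ⋆ Q = 1) (n : ℕ) :
    spow (Q ⋆ X ⋆ R) n = Q ⋆ spow X n ⋆ R := by
  induction n with
  | zero => rw [spow, spow, smatMul_one, hQR]
  | succ n ih =>
    rw [spow, ih, spow, smatMul_assoc (hQ.mul (hX' n)) hR, smatMul_assoc hQ hX,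
      ← smatMul_assoc hR hQ, hRQ, one_smatMul, ← smatMul_assoc (hQ.mul (hX' n)) hX,
      smatMul_assoc hQ (hX' n)]

/-! ### The group `𝒢_𝐤` -/

/-- `a ∈ 𝐤`, with diagonal blocks `c n • 1`. -/
def IsKWith (c : ℕ → ℂ) (a : SMat) : Prop :=
  ∀ i j, i / 2 ≤ j / 2 → a i j = if i = j then c (i / 2) else 0

theorem isK_iff (a : SMat) : IsK a ↔ ∃ c, IsKWith c a := by
  constructor
  · rintro ⟨hu, c, hc⟩
    refine ⟨c, fun i j hij => ?_⟩
    rcases hij.lt_or_eq with h | h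
    · have := congrFun (congrFun hu i) j
      rw [if_neg (by rintro rfl; exact lt_irrefl _ h)]
      simpa [upperPart, h] using this
    · have := congrFun (congrFun hc i) j
      simpa [diagPart, h, Matrix.diagonal_apply] using this
  · rintro ⟨c, hc⟩
    refine ⟨?_, c, ?_⟩
    · ext i j
      simp only [upperPart, Matrix.of_apply, Matrix.zero_apply]
      split_ifs with h
      · rw [hc i j h.le, if_neg (by rintro rfl; exact lt_irrefl _ h)]
      · rfl
    · ext i j
      simp only [diagPart, Matrix.of_apply, Matrix.diagonal_apply]
      split_ifs with h h' h'
      · rw [hc i j h.le, if_pos h']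
      · rw [hc i j h.le, if_neg h']
      · exact absurd (by rw [h']) h
      · rfl

theorem IsKWith.diag {c : ℕ → ℂ} {a : SMat} (h : IsKWith c a) (i : ℕ) : a i i = c (i / 2) := by
  rw [h i i le_rfl, if_pos rfl]

theorem IsKWith.eq_zero {c : ℕ → ℂ} {a : SMat} (h : IsKWith c a) {i j : ℕ} (hij : i < j) :
    a i j = 0 := by
  rw [h i j (by omega), if_neg hij.ne]

theorem IsKWith.rowFin {c : ℕ → ℂ} {a : SMat} (h : IsKWith c a) : RowFin a := fun i =>
  ⟨i + 1, fun _ hj => h.eq_zero hj⟩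

theorem IsK.rowFin {a : SMat} (h : IsK a) : RowFin a := by
  obtain ⟨c, hc⟩ := (isK_iff a).mp h
  exact hc.rowFin

theorem IsKWith.mul {c d : ℕ → ℂ} {a b : SMat} (ha : IsKWith c a) (hb : IsKWith d b) :
    IsKWith (fun n => c n * d n) (a ⋆ b) := by
  intro i j hij
  simp only [smatMul, Matrix.of_apply]
  rw [finsum_eq_single _ i, ha.diag, hb i j hij]
  · split_ifs <;> simp
  · intro k hk
    rcases lt_or_ge (k / 2) (i / 2) with h | h
    · rw [hb k j (by omega), if_neg (by rintro rfl; omega), mul_zero]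
    · rw [ha i k h, if_neg hk.symm, zero_mul]

/-- Forward substitution row by row; it works for full matrices `b` and `b'`. -/
theorem IsKWith.left_cancel {c : ℕ → ℂ} {a : SMat} (ha : IsKWith c a) (hc : ∀ n, c n ≠ 0)
    {b b' : SMat} (h : a ⋆ b = a ⋆ b') : b = b' := by
  ext i j
  induction i using Nat.strong_induction_on with
  | _ i ih =>
    have := congrFun (congrFun h i) j
    rw [smatMul_apply_of_row (N := i + 1) (fun k hk => ha.eq_zero hk),
      smatMul_apply_of_row (N := i + 1) (fun k hk => ha.eq_zero hk), Finset.sum_range_succ,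
      Finset.sum_range_succ, Finset.sum_congr rfl fun k hk => by rw [ih k (Finset.mem_range.mp hk)],
      add_right_inj, ha.diag] at this
    exact mul_left_cancel₀ (hc _) this

/-- The right inverse is not assumed triangular, because the one available later, `-m Qᵀ J`, does
not look so. Forward substitution shows that it lies in `𝐤`; then `a (b a) = a` can be cancelled on
the left. -/
theorem IsKWith.inverse {c : ℕ → ℂ} {a b : SMat} (ha : IsKWith c a) (hc : ∀ n, c n ≠ 0)
    (hab : a ⋆ b = 1) : IsKWith (fun n => (c n)⁻¹) b ∧ b ⋆ a = 1 := by
  have hb : IsKWith (fun n => (c n)⁻¹) b := by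
    intro i
    induction i using Nat.strong_induction_on with
    | _ i ih =>
      intro j hij
      have h := congrFun (congrFun hab i) j
      simp only [smatMul, Matrix.of_apply] at h
      rw [finsum_eq_single _ i, ha.diag, Matrix.one_apply] at h
      · have := hc (i / 2)
        rw [← mul_right_inj' this, h]
        split_ifs
        · rw [mul_inv_cancel₀ this]
        · rw [mul_zero]
      · intro k hk
        rcases lt_or_ge (k / 2) (i / 2) with h | h
        · rw [ih k (by omega) j (by omega), if_neg (by rintro rfl; omega), mul_zero]
        · rw [ha i k h, if_neg hk.symm, zero_mul]
  refine ⟨hb, ha.left_cancel hc ?_⟩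
  rw [← smatMul_assoc ha.rowFin hb.rowFin, hab, one_smatMul, smatMul_one]

theorem isGK_of_mul_eq_one {c : ℕ → ℂ} {a b : SMat} (ha : IsKWith c a) (hc : ∀ n, c n ≠ 0)
    (hab : a ⋆ b = 1) : IsGK a ∧ gInv a = b := by
  obtain ⟨hb, hba⟩ := ha.inverse hc hab
  have hex : ∃ R : SMat, IsK R ∧ a ⋆ R = 1 ∧ R ⋆ a = 1 := ⟨b, (isK_iff b).mpr ⟨_, hb⟩, hab, hba⟩
  refine ⟨⟨(isK_iff a).mpr ⟨_, ha⟩, hex⟩, ?_⟩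
  rw [gInv, dif_pos hex]
  exact ha.left_cancel hc (hex.choose_spec.2.1.trans hab.symm)

theorem IsGK.exists_with {a : SMat} (h : IsGK a) :
    ∃ c d : ℕ → ℂ, IsKWith c a ∧ IsKWith d (gInv a) ∧ (∀ n, c n * d n = 1) ∧
      a ⋆ gInv a = 1 ∧ gInv a ⋆ a = 1 := by
  obtain ⟨ha, hex⟩ := h
  obtain ⟨c, hc⟩ := (isK_iff a).mp ha
  have hs := hex.choose_spec
  have hg : gInv a = hex.choose := by rw [gInv, dif_pos hex]
  rw [← hg] at hs
  obtain ⟨d, hd⟩ := (isK_iff _).mp hs.1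
  refine ⟨c, d, hc, hd, fun n => ?_, hs.2⟩
  have h1 := (hc.mul hd).diag (2 * n)
  rw [hs.2.1, Matrix.one_apply_eq, Nat.mul_div_cancel_left n two_pos] at h1
  exact h1.symm

/-- For `Q` with inverse `R`, `m = R J Rᵀ` is equivalent to `Q m Qᵀ = J`. -/
theorem eq_conj_Jmat_iff {m Q R : SMat} (hQ : RowFin Q) (hR : RowFin R) (hQR : Q ⋆ R = 1)
    (hRQ : R ⋆ Q = 1) :
    m = R ⋆ Jmat ⋆ R.transpose ↔ Q ⋆ m ⋆ Q.transpose = Jmat := by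
  have hQRt : R.transpose ⋆ Q.transpose = 1 := by
    rw [← smatMul_transpose, hQR, Matrix.transpose_one]
  have hRQt : Q.transpose ⋆ R.transpose = 1 := by
    rw [← smatMul_transpose, hRQ, Matrix.transpose_one]
  constructor
  · rintro rfl
    rw [← smatMul_assoc hQ (hR.mul rowFin_Jmat), ← smatMul_assoc hQ hR, hQR, one_smatMul,
      smatMul_assoc_of_col (C := Q.transpose) rowFin_Jmat hQ, hQRt, smatMul_one]
  · intro h
    rw [← h, smatMul_assoc_of_col hQ (C := Q.transpose) hQ, ← smatMul_assoc hR hQ, hRQ, one_smatMul,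
      smatMul_assoc_of_col_col (B := Q.transpose) (C := R.transpose) hQ hR, hRQt, smatMul_one]

theorem isSkewBorel_iff {m Q : SMat} (hQ : IsGK Q) :
    IsSkewBorel m Q ↔ Q ⋆ m ⋆ Q.transpose = Jmat := by
  obtain ⟨c, d, hc, hd, -, h1, h2⟩ := hQ.exists_with
  rw [IsSkewBorel, and_iff_right hQ, eq_conj_Jmat_iff hc.rowFin hd.rowFin h1 h2]

/-- An element of `𝐤` that preserves `J` is diagonal with entries `±1`. -/
theorem IsKWith.eq_diagonal {c d : ℕ → ℂ} {S T : SMat} (hS : IsKWith c S) (hT : IsKWith d T)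
    (hTS : T ⋆ S = 1) (h : S ⋆ Jmat ⋆ S.transpose = Jmat) :
    S = Matrix.diagonal (fun i => c (i / 2)) ∧ ∀ n, c n = 1 ∨ c n = -1 := by
  have hTSt : S.transpose ⋆ T.transpose = 1 := by
    rw [← smatMul_transpose, hTS, Matrix.transpose_one]
  have hSJ : S ⋆ Jmat = Jmat ⋆ T.transpose := by
    rw [← smatMul_one (S ⋆ Jmat), ← hTSt, ← smatMul_assoc_of_col_col (B := S.transpose)
      (C := T.transpose) hS.rowFin hT.rowFin, h]
  -- The twist by `J` reflects in the diagonal: blocks of `S` below the diagonal become blocks of `T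
  -- = S⁻¹` above it, which vanish. On the diagonal it gives `c n = d n`, so `c n ^ 2 = 1`.
  have hentry : ∀ i j, S i j = rowSign i * rowSign j * T (partner j) (partner i) := by
    intro i j
    have := congrFun (congrFun hSJ i) (partner j)
    rw [smatMul_Jmat, Jmat_smatMul, partner_partner, rowSign_partner, Matrix.transpose_apply] at this
    linear_combination rowSign j * this - S i j * rowSign_mul_self j
  constructor
  · ext i j
    rw [Matrix.diagonal_apply]
    rcases le_or_gt (i / 2) (j / 2) with hij | hij
    · exact hS i j hij
    · rw [hentry, hT _ _ (by rw [partner_div, partner_div]; exact hij.le),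
        if_neg (fun h => by have h1 := partner_div i; have h2 := partner_div j; omega), mul_zero,
        if_neg (by rintro rfl; exact lt_irrefl _ hij)]
  · intro n
    have h1 := hentry (2 * n) (2 * n)
    rw [hS.diag, hT.diag, rowSign_mul_self, one_mul, partner_div] at h1
    have h2 := (hT.mul hS).diag (2 * n)
    rw [hTS, Matrix.one_apply_eq] at h2
    rw [← h1, Nat.mul_div_cancel_left n two_pos] at h2
    exact mul_self_eq_one_iff.mp h2.symm

theorem piK_diagPart (a : SMat) : piK (diagPart a) = diagPart (piK a) := by
  ext i j
  simp only [piK, diagPart, lowerPart, upperPart, Matrix.of_apply, Matrix.add_apply,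
    Matrix.sub_apply, Matrix.smul_apply, calJ_apply, partner_div]
  split_ifs <;> first | omega | simp

/-! ### The polynomials `p_k` -/

theorem skew_apply {m : SMat} (hs : m.transpose = -m) (i j : ℕ) : m i j = -m j i := by
  have := congrFun (congrFun hs j) i
  simpa using this

theorem skew_apply_self {m : SMat} (hs : m.transpose = -m) (i : ℕ) : m i i = 0 :=
  self_eq_neg.mp (skew_apply hs i i)

theorem pPoly_even (m : SMat) (n : ℕ) :
    pPoly m (2 * n) = C (tauT m n)⁻¹ * pfaffian (n + 1) (bordered m n (2 * n + 1)) := by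
  rw [pPoly, if_pos (by omega), Nat.mul_div_cancel_left n two_pos]

theorem pPoly_odd (m : SMat) (n : ℕ) :
    pPoly m (2 * n + 1) = -(C (tauT m n)⁻¹ * pfaffian (n + 1) (bordered m n (2 * n))) := by
  have h : (2 * n + 1) / 2 = n := by omega
  rw [pPoly, if_neg (by omega), h, Nat.add_sub_cancel]

theorem map_pfaffian_bordered_even (m : SMat) (n : ℕ) (φ : ℂ[X] →ₗ[ℂ] ℂ) :
    φ (pfaffian (n + 1) (bordered m n (2 * n)))
      = pfaffian (n + 1) (borderedBy m n (2 * n) fun a => φ (X ^ a)) :=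
  map_pfaffian_bordered m n ⟨2 * n, by omega⟩ φ

theorem map_pfaffian_bordered_odd (m : SMat) (n : ℕ) (φ : ℂ[X] →ₗ[ℂ] ℂ) :
    φ (pfaffian (n + 1) (bordered m n (2 * n + 1)))
      = pfaffian (n + 1) (borderedBy m n (2 * n + 1) fun a => φ (X ^ a)) :=
  map_pfaffian_bordered m n ⟨2 * n + 1, by omega⟩ φ

theorem map_pPoly_even (m : SMat) (n : ℕ) (φ : ℂ[X] →ₗ[ℂ] ℂ) :
    φ (pPoly m (2 * n)) = (tauT m n)⁻¹ *
      pfaffian (n + 1) (borderedBy m n (2 * n + 1) fun a => φ (X ^ a)) := by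
  rw [pPoly_even, ← smul_eq_C_mul, map_smul, smul_eq_mul, map_pfaffian_bordered_odd]

theorem map_pPoly_odd (m : SMat) (n : ℕ) (φ : ℂ[X] →ₗ[ℂ] ℂ) :
    φ (pPoly m (2 * n + 1)) = -((tauT m n)⁻¹ *
      pfaffian (n + 1) (borderedBy m n (2 * n) fun a => φ (X ^ a))) := by
  rw [pPoly_odd, map_neg, ← smul_eq_C_mul, map_smul, smul_eq_mul, map_pfaffian_bordered_even]

theorem borderedBy_skew {m : SMat} (hs : m.transpose = -m) (n c : ℕ) (v : ℕ → ℂ)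
    (a b : Fin (2 * (n + 1))) : borderedBy m n c v a b = -borderedBy m n c v b a := by
  simp only [borderedBy, Matrix.of_apply]
  split_ifs
  · simp
  · rfl
  · simp
  · exact skew_apply hs _ _

theorem val_swap_last (n : ℕ) (a : Fin (2 * (n + 1))) :
    ((Equiv.swap (evenPos (Fin.last n)) (oddPos (Fin.last n)) a : Fin (2 * (n + 1))) : ℕ)
      = if (a : ℕ) = 2 * n then 2 * n + 1 else if (a : ℕ) = 2 * n + 1 then 2 * n else a := by
  rw [Equiv.swap_apply_def]
  simp only [evenPos, oddPos, Fin.ext_iff, Fin.val_last]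
  split_ifs <;> rfl

/-- The last column has at most the entry `v (2n)`, so `pfaffian_last` applies. -/
theorem pfaffian_borderedBy_odd {m : SMat} (hs : m.transpose = -m) (n : ℕ) (v : ℕ → ℂ)
    (hv : ∀ a < 2 * n, v a = 0) :
    pfaffian (n + 1) (borderedBy m n (2 * n + 1) v) = v (2 * n) * tauT m n := by
  rw [pfaffian_last _ (borderedBy_skew hs _ _ _)]
  · congr 1
    · simp [borderedBy, evenPos, oddPos]
    · rw [tauT]
      congr 1
      ext a b
      have ha : (a : ℕ) ≠ 2 * n + 1 := by omega
      have hb : (b : ℕ) ≠ 2 * n + 1 := by omega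
      simp [borderedBy, ha, hb]
  · intro a ha
    have ha' : (a : ℕ) ≠ 2 * n := fun h => ha (Fin.ext h)
    simp only [borderedBy, oddPos, Matrix.of_apply, Fin.val_last, if_true]
    split_ifs with h
    · rfl
    · exact hv _ (by omega)

/-- Exchanging the last two positions brings the border to the end; this is the source of the minus
sign in the odd `p_k`. -/
theorem pfaffian_borderedBy_even {m : SMat} (hs : m.transpose = -m) (n : ℕ) (v : ℕ → ℂ)
    (hv : ∀ a < 2 * n, v a = 0) :
    pfaffian (n + 1) (borderedBy m n (2 * n) v) = -(v (2 * n + 1) * tauT m n) := by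
  rw [← neg_eq_iff_eq_neg, ← pfaffian_submatrix_swap _ (evenPos_ne_oddPos (Fin.last n) (Fin.last n)),
    pfaffian_last]
  · congr 1
    · simp [borderedBy, evenPos, oddPos]
    · rw [tauT]
      congr 1
      ext a b
      have ha : (a : ℕ) ≠ 2 * n + 1 := by omega
      have hb : (b : ℕ) ≠ 2 * n + 1 := by omega
      simp [borderedBy, val_swap_last, ha, hb, a.2.ne, b.2.ne]
  · exact fun a b => borderedBy_skew hs _ _ _ _ _
  · intro a ha
    have ha' : (a : ℕ) ≠ 2 * n := fun h => ha (Fin.ext h)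
    simp only [borderedBy, Matrix.of_apply, Matrix.submatrix_apply, Equiv.swap_apply_right]
    rw [val_swap_last, if_neg ha']
    simp only [evenPos, Fin.val_last, if_true]
    split_ifs with h h'
    · rfl
    · exact absurd rfl h'
    · exact hv _ (by omega)

/-- The matrix of coefficients of the `p_k`. -/
def PMat (m : SMat) : SMat := Matrix.of fun i j => (pPoly m i).coeff j

/-- For `i = 2n` or `2n+1` and `j ≥ 2n`, the `j`-th coefficient functional gives a border vanishing
before `2n`. Besides monicity this yields the missing `z^{2n}` term of `p_{2n+1}`, which makes the
diagonal blocks scalar. -/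
theorem isKWith_PMat {m : SMat} (hs : m.transpose = -m) (hτ : ∀ n, tauT m n ≠ 0) :
    IsKWith (fun _ => 1) (PMat m) := by
  intro i j hij
  have hX : ∀ a, lcoeff ℂ j (X ^ a) = if j = a then (1 : ℂ) else 0 := fun a => by
    rw [lcoeff_apply, coeff_X_pow]
  rw [PMat, Matrix.of_apply, ← lcoeff_apply]
  rcases Nat.even_or_odd' i with ⟨n, rfl | rfl⟩
  · rw [map_pPoly_even]
    simp only [hX]
    rw [pfaffian_borderedBy_odd hs _ _ fun a ha => if_neg (by omega), mul_comm, mul_assoc,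
      mul_inv_cancel₀ (hτ n), mul_one]
    simp only [eq_comm]
  · rw [map_pPoly_odd]
    simp only [hX]
    rw [pfaffian_borderedBy_even hs _ _ fun a ha => if_neg (by omega), mul_neg, neg_neg, mul_comm,
      mul_assoc, mul_inv_cancel₀ (hτ n), mul_one]
    simp only [eq_comm]

theorem monic_pPoly {m : SMat} (hs : m.transpose = -m) (hτ : ∀ n, tauT m n ≠ 0) (k : ℕ) :
    (pPoly m k).Monic ∧ (pPoly m k).natDegree = k := by
  have h := isKWith_PMat hs hτ
  have h1 : (pPoly m k).coeff k = 1 := h.diag k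
  have hle : (pPoly m k).natDegree ≤ k :=
    natDegree_le_iff_coeff_eq_zero.mpr fun N hN => h.eq_zero hN
  exact ⟨monic_of_natDegree_le_of_coeff_eq_one k hle h1,
    natDegree_eq_of_le_of_coeff_ne_zero hle (by rw [h1]; exact one_ne_zero)⟩

/-! ### Skew-orthogonality of the polynomials. -/

/-- The linear form `f ↦ ⟨f, z^j⟩`. -/
def pairPow (m : SMat) (j : ℕ) : ℂ[X] →ₗ[ℂ] ℂ :=
  Polynomial.lsum fun i => m i j • (LinearMap.id : ℂ →ₗ[ℂ] ℂ)

theorem pairPow_X_pow (m : SMat) (j a : ℕ) : pairPow m j (X ^ a) = m a j := by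
  rw [pairPow, Polynomial.lsum_apply, X_pow_eq_monomial, sum_monomial_index] <;> simp

theorem skewInner_eq (m : SMat) (f g : ℂ[X]) :
    skewInner m f g = g.sum fun j b => b * pairPow m j f := by
  simp only [skewInner, pairPow, Polynomial.lsum_apply, Polynomial.sum, Finset.mul_sum]
  rw [Finset.sum_comm]
  refine Finset.sum_congr rfl fun j _ => Finset.sum_congr rfl fun i _ => ?_
  simp only [LinearMap.smul_apply, LinearMap.id_apply, smul_eq_mul]
  ring

theorem skewInner_skew {m : SMat} (hs : m.transpose = -m) (f g : ℂ[X]) :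
    skewInner m f g = -skewInner m g f := by
  simp only [skewInner, Polynomial.sum]
  rw [Finset.sum_comm, ← Finset.sum_neg_distrib]
  refine Finset.sum_congr rfl fun j _ => ?_
  rw [← Finset.sum_neg_distrib]
  refine Finset.sum_congr rfl fun i _ => ?_
  rw [skew_apply hs i j]
  ring

/-- Entries of a matrix with one border, `none` being the index of the border. -/
def borderEntry (m : SMat) (v : ℕ → ℂ) : Option ℕ → Option ℕ → ℂ
  | none, none => 0
  | none, some b => -v b
  | some a, none => v a
  | some a, some b => m a b

/-- The bordered matrix is `m` with index `c` replaced by `j`; the zero at the crossing agrees with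
`m j j = 0`. If `j ≠ c`, the index `j` occurs twice. -/
theorem pfaffian_borderedBy_pair {m : SMat} (hs : m.transpose = -m) (n : ℕ)
    (c : Fin (2 * (n + 1))) {j : ℕ} (hj : j < 2 * (n + 1)) :
    pfaffian (n + 1) (borderedBy m n c fun a => m a j)
      = if j = c then tauT m (n + 1) else 0 := by
  let f : Fin (2 * (n + 1)) → ℕ := fun a => if (a : ℕ) = c then j else a
  have h : (borderedBy m n c fun a => m a j) = Matrix.of fun a b => m (f a) (f b) := by
    ext a b
    simp only [borderedBy, Matrix.of_apply, f]
    split_ifs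
    · exact (skew_apply_self hs j).symm
    · exact (skew_apply hs _ _).symm
    · rfl
    · rfl
  rw [h]
  split_ifs with hc
  · rw [tauT]
    have hf : ∀ a, f a = a := fun a => by simp only [f]; split_ifs with h1 <;> omega
    simp only [hf]
  · refine pfaffian_eq_zero_of_repeat m f (x := c) (y := ⟨j, hj⟩)
      (fun h' => hc (by rw [h'])) ?_
    simp [f]

theorem pairPow_pPoly {m : SMat} (hs : m.transpose = -m) {i j : ℕ} (hij : j / 2 ≤ i / 2) :
    pairPow m j (pPoly m i) = if j = partner i then rowSign i * hT m (i / 2) else 0 := by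
  rcases Nat.even_or_odd' i with ⟨n, rfl | rfl⟩
  · have hp : partner (2 * n) = 2 * n + 1 := by simp [partner]
    have hr : rowSign (2 * n) = 1 := by simp [rowSign]
    rw [map_pPoly_even]
    simp only [pairPow_X_pow]
    rw [pfaffian_borderedBy_pair hs n ⟨2 * n + 1, by omega⟩ (by omega), hp, hr, hT,
      Nat.mul_div_cancel_left n two_pos]
    simp only
    split_ifs
    · ring
    · ring
  · have hp : partner (2 * n + 1) = 2 * n := by simp [partner]
    have hr : rowSign (2 * n + 1) = -1 := by simp [rowSign]
    have h2 : (2 * n + 1) / 2 = n := by omega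
    rw [map_pPoly_odd]
    simp only [pairPow_X_pow]
    rw [pfaffian_borderedBy_pair hs n ⟨2 * n, by omega⟩ (by omega), hp, hr, hT, h2]
    simp only
    split_ifs
    · ring
    · ring

/-- By skewness it suffices to treat `j / 2 ≤ i / 2`. Then every power `z^l` in `p_j` lies within
the range of `pairPow_pPoly`, and only `l = partner i` pairs nontrivially with `p_i`. -/
theorem skewInner_pPoly {m : SMat} (hs : m.transpose = -m) (hτ : ∀ n, tauT m n ≠ 0) (i j : ℕ) :
    skewInner m (pPoly m i) (pPoly m j) = (Jmat ⋆ hMat m) i j := by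
  have hle : ∀ i j, j / 2 ≤ i / 2 → skewInner m (pPoly m i) (pPoly m j)
      = if j = partner i then rowSign i * hT m (i / 2) else 0 := by
    intro i j hij
    have hcoeff : (pPoly m j).coeff (partner i) = if j = partner i then 1 else 0 :=
      isKWith_PMat hs hτ j (partner i) (by rw [partner_div]; exact hij)
    have hterm : ∀ l ∈ (pPoly m j).support, l ≠ partner i →
        (pPoly m j).coeff l * pairPow m l (pPoly m i) = 0 := by
      intro l hl hne
      have hl' : l ≤ j := by
        have := le_natDegree_of_mem_supp l hl
        rwa [(monic_pPoly hs hτ j).2] at this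
      rw [pairPow_pPoly hs (by omega), if_neg hne, mul_zero]
    rw [skewInner_eq, Polynomial.sum, Finset.sum_eq_single (partner i) hterm]
    · rw [hcoeff, pairPow_pPoly hs (partner_div i).le, if_pos rfl]
      split_ifs <;> simp
    · intro h
      rw [notMem_support_iff.mp h, zero_mul]
  have hR : (Jmat ⋆ hMat m) i j = if j = partner i then rowSign i * hT m (i / 2) else 0 := by
    rw [Jmat_smatMul, hMat, Matrix.diagonal_apply, partner_div]
    simp only [eq_comm (a := j)]
    split_ifs <;> simp
  rw [hR]
  rcases le_total (j / 2) (i / 2) with h | h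
  · exact hle i j h
  · rw [skewInner_skew hs, hle j i h]
    by_cases hj : j = partner i
    · subst hj
      rw [partner_partner, if_pos rfl, if_pos rfl, rowSign_partner, partner_div]; ring
    · rw [if_neg hj, if_neg (by rintro rfl; exact hj (partner_partner j).symm), neg_zero]

/-! ### Time derivatives of Pfaffians -/

theorem flow_apply (m : SMat) (k i j : ℕ) :
    (spow shiftMat k ⋆ m + m ⋆ spow shiftMat.transpose k) i j = m (i + k) j + m i (j + k) := by
  have h : ∀ (m : SMat) i j, (spow shiftMat k ⋆ m) i j = m (i + k) j := by
    intro m i j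
    simp only [smatMul, Matrix.of_apply, spow_shiftMat_apply]
    rw [finsum_eq_single _ (i + k)]
    · simp
    · intro l hl
      simp [hl]
  rw [Matrix.add_apply, h, spow_shiftMat_transpose]
  congr 1
  have := h m.transpose j i
  rw [← Matrix.transpose_transpose (spow shiftMat k), ← smatMul_transpose] at this
  exact this

/-- The index `a`, raised by one if it is `c`; the position of the border is `2n + 1`. -/
def raisedIndex (n c a : ℕ) : Option ℕ :=
  if a = 2 * n + 1 then none else if a = c then some (a + 1) else some a

/-- The bordered matrix with border in the last place and with the index `c` raised by one. -/
def raisedBordered (m : SMat) (n c : ℕ) (v : ℕ → ℂ) :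
    Matrix (Fin (2 * (n + 1))) (Fin (2 * (n + 1))) ℂ :=
  Matrix.of fun a b => borderEntry m v (raisedIndex n c a) (raisedIndex n c b)

/-- The raised index `c + 1 ≤ 2n` is already present. -/
theorem pfaffian_raisedBordered_of_lt (m : SMat) (n c : ℕ) (v : ℕ → ℂ) (hc : c < 2 * n) :
    pfaffian (n + 1) (raisedBordered m n c v) = 0 := by
  refine pfaffian_eq_zero_of_repeat _ (fun a => raisedIndex n c a) (x := ⟨c, by omega⟩)
    (y := ⟨c + 1, by omega⟩) (by simp [Fin.ext_iff]) ?_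
  simp only [raisedIndex]
  rw [if_neg (by omega), if_pos trivial, if_neg (by omega), if_neg (by omega)]

/-- Raising `2n` gives the indices `0, …, 2n-1, 2n+1` and then the border; exchanging the last two
positions gives the matrix that defines `p_{2n+1}`. -/
theorem pfaffian_raisedBordered_last (m : SMat) (n : ℕ) (v : ℕ → ℂ) :
    pfaffian (n + 1) (raisedBordered m n (2 * n) v)
      = -pfaffian (n + 1) (borderedBy m n (2 * n) v) := by
  rw [← pfaffian_submatrix_swap _ (evenPos_ne_oddPos (Fin.last n) (Fin.last n))]
  congr 1
  ext a b
  simp only [raisedBordered, Matrix.submatrix_apply, borderedBy, Matrix.of_apply, val_swap_last]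
  have hcase : ∀ x : ℕ, x = 2 * n + 1 ∨ x = 2 * n ∨ (x ≠ 2 * n ∧ x ≠ 2 * n + 1) := by omega
  rcases hcase a with ha | ha | ⟨ha, ha'⟩ <;> rcases hcase b with hb | hb | ⟨hb, hb'⟩ <;>
    simp [raisedIndex, borderEntry, *]

theorem borderEntry_raisedIndex_add {m : SMat} (hs : m.transpose = -m) (n : ℕ) (v : ℕ → ℂ)
    {a b : ℕ} (ha : a ≠ 2 * n + 1) (hb : b ≠ 2 * n + 1) :
    borderEntry m v (raisedIndex n a a) (raisedIndex n a b)
      + borderEntry m v (raisedIndex n b a) (raisedIndex n b b) = m (a + 1) b + m a (b + 1) := by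
  -- On the diagonal both occurrences are raised at once, giving `m (a+1) (a+1) = 0`; the right side
  -- also vanishes, by skewness.
  by_cases hab : a = b
  · subst hab
    simp [raisedIndex, ha, borderEntry, skew_apply_self hs, skew_apply hs (a + 1) a]
  · simp [raisedIndex, ha, hb, hab, Ne.symm hab, borderEntry]

/-- `(z + ∂/∂t₁)` raises the last index of the bordered Pfaffian `pf(0, …, 2n, z)`. -/
theorem hasPartial_pfaffian_bordered {U : Set Times} {m : Times → SMat} {t : Times}
    (hs : (m t).transpose = -m t)
    (hm : HasMatPartial U 1 m (spow shiftMat (1 : ℕ+) ⋆ m t +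
      m t ⋆ spow shiftMat.transpose (1 : ℕ+)) t) (n : ℕ) (φ : ℂ[X] →ₗ[ℂ] ℂ) :
    HasPartial U 1 (fun u => φ (pfaffian (n + 1) (bordered (m u) n (2 * n + 1))))
      (-φ (pfaffian (n + 1) (bordered (m t) n (2 * n)))
        - φ (X * pfaffian (n + 1) (bordered (m t) n (2 * n + 1)))) t := by
  have hψ : -φ (X * pfaffian (n + 1) (bordered (m t) n (2 * n + 1)))
      = pfaffian (n + 1) (borderedBy (m t) n (2 * n + 1) fun a => -φ (X ^ (a + 1))) := by
    refine (map_pfaffian_bordered_odd (m t) n (-(φ ∘ₗ LinearMap.mulLeft ℂ X))).trans ?_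
    simp only [LinearMap.neg_apply, LinearMap.comp_apply, LinearMap.mulLeft_apply, ← pow_succ']
  rw [sub_eq_add_neg, hψ]
  simp only [map_pfaffian_bordered_even, map_pfaffian_bordered_odd]
  generalize hv : (fun a => φ (X ^ a)) = v
  have hv' : (fun a => -φ (X ^ (a + 1))) = fun a => -v (a + 1) := by rw [← hv]
  rw [hv']
  -- The border is constant in time, but raising the index `a` turns its entry into `v (a + 1)`. The
  -- border index must compensate with `-v (a + 1)`, and this contribution is the term `-z` times
  -- the Pfaffian.
  let G : Fin (2 * (n + 1)) → Matrix (Fin (2 * (n + 1))) (Fin (2 * (n + 1))) ℂ := fun c =>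
    if (c : ℕ) = 2 * n + 1 then borderedBy (m t) n (2 * n + 1) fun a => -v (a + 1)
    else raisedBordered (m t) n c v
  have hG1 : ∀ c : Fin (2 * (n + 1)), (c : ℕ) = 2 * n + 1 →
      G c = borderedBy (m t) n (2 * n + 1) fun a => -v (a + 1) := fun c hc => if_pos hc
  have hG2 : ∀ c : Fin (2 * (n + 1)), (c : ℕ) ≠ 2 * n + 1 →
      G c = raisedBordered (m t) n c v := fun c hc => if_neg hc
  clear_value G
  have hsum : ∑ c, pfaffian (n + 1) (G c) = -pfaffian (n + 1) (borderedBy (m t) n (2 * n) v)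
      + pfaffian (n + 1) (borderedBy (m t) n (2 * n + 1) fun a => -v (a + 1)) := by
    rw [Finset.sum_eq_add (evenPos (Fin.last n)) (oddPos (Fin.last n)) (evenPos_ne_oddPos _ _)
      _ (fun h => absurd (Finset.mem_univ _) h) (fun h => absurd (Finset.mem_univ _) h),
      hG2 (evenPos (Fin.last n)) (by simp [evenPos]), hG1 (oddPos (Fin.last n)) (by simp [oddPos]),
      ← pfaffian_raisedBordered_last]
    · rfl
    · rintro c - ⟨hc1, hc2⟩
      have hc1' : (c : ℕ) ≠ 2 * n := fun h => hc1 (Fin.ext h)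
      have hc2' : (c : ℕ) ≠ 2 * n + 1 := fun h => hc2 (Fin.ext h)
      rw [hG2 c hc2', pfaffian_raisedBordered_of_lt _ _ _ _ (by omega)]
  rw [← hsum]
  have hA : ∀ a b : Fin (2 * (n + 1)), HasDerivWithinAt
      (fun s : ℂ => borderedBy (m (t + Pi.single 1 s)) n (2 * n + 1) v a b)
      (G a a b + G b a b) (slice U 1 t) 0 := by
    intro a b
    by_cases ha : (a : ℕ) = 2 * n + 1
    · rw [hG1 a ha]
      by_cases hb : (b : ℕ) = 2 * n + 1
      · rw [hG1 b hb]
        simpa [borderedBy, ha, hb] using hasDerivWithinAt_const _ _ _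
      · rw [hG2 b hb]
        simpa [borderedBy, ha, hb, raisedBordered, raisedIndex, borderEntry]
          using hasDerivWithinAt_const _ _ _
    · rw [hG2 a ha]
      by_cases hb : (b : ℕ) = 2 * n + 1
      · rw [hG1 b hb]
        simpa [borderedBy, ha, hb, raisedBordered, raisedIndex, borderEntry]
          using hasDerivWithinAt_const _ _ _
      · have h := hm a b
        rw [flow_apply, PNat.one_coe, ← borderEntry_raisedIndex_add hs n v ha hb] at h
        rw [hG2 b hb]
        simp only [borderedBy, Matrix.of_apply, ha, hb, if_false]
        exact h
  have hG : ∀ c a b : Fin (2 * (n + 1)), a ≠ c → b ≠ c →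
      G c a b = borderedBy (m (t + Pi.single 1 0)) n (2 * n + 1) v a b := by
    intro c a b ha hb
    by_cases hc : (c : ℕ) = 2 * n + 1
    · have ha' : (a : ℕ) ≠ 2 * n + 1 := fun h => ha (Fin.ext (h.trans hc.symm))
      have hb' : (b : ℕ) ≠ 2 * n + 1 := fun h => hb (Fin.ext (h.trans hc.symm))
      simp [hG1 c hc, borderedBy, ha', hb']
    · have ha' : (a : ℕ) ≠ c := fun h => ha (Fin.ext h)
      have hb' : (b : ℕ) ≠ c := fun h => hb (Fin.ext h)
      simp only [hG2 c hc, raisedBordered, raisedIndex, borderedBy, Matrix.of_apply,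
        Pi.single_zero, add_zero, ha', hb', if_false]
      split_ifs <;> simp [borderEntry]
  exact hasDerivWithinAt_pfaffian hA hG

theorem HasPartial.congr {U : Set Times} {k : ℕ+} {f g : Times → ℂ} {f' : ℂ} {t : Times}
    (h : HasPartial U k f f' t) (ht : t ∈ U) (hfg : ∀ u ∈ U, g u = f u) :
    HasPartial U k g f' t :=
  HasDerivWithinAt.congr h (fun _ hs => hfg _ hs) (hfg _ (by simpa using ht))

theorem exists_hasPolyPartial {U : Set Times} {m : Times → SMat} {t : Times} (ht : t ∈ U)
    (hs : (m t).transpose = -m t)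
    (hm : HasMatPartial U 1 m (spow shiftMat (1 : ℕ+) ⋆ m t +
      m t ⋆ spow shiftMat.transpose (1 : ℕ+)) t) (n : ℕ) (hτ : ∀ u ∈ U, tauT (m u) n ≠ 0) :
    ∃ D : Polynomial ℂ,
      HasPolyPartial U 1 (fun u => C (tauT (m u) n) * pPoly (m u) (2 * n)) D t ∧
      pPoly (m t) (2 * n + 1) = C (tauT (m t) n)⁻¹ *
        (X * (C (tauT (m t) n) * pPoly (m t) (2 * n)) + D) := by
  have heven : ∀ u ∈ U, C (tauT (m u) n) * pPoly (m u) (2 * n)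
      = pfaffian (n + 1) (bordered (m u) n (2 * n + 1)) := by
    intro u hu
    rw [pPoly_even, ← mul_assoc, ← C_mul, mul_inv_cancel₀ (hτ u hu), C_1, one_mul]
  refine ⟨-pfaffian (n + 1) (bordered (m t) n (2 * n))
    - X * pfaffian (n + 1) (bordered (m t) n (2 * n + 1)), fun j => ?_, ?_⟩
  · rw [coeff_sub, coeff_neg]
    exact (hasPartial_pfaffian_bordered hs hm n (lcoeff ℂ j)).congr ht fun u hu => by
      simp only [heven u hu, lcoeff_apply]
  · rw [heven t ht, pPoly_odd]
    ring

theorem differentiableWithinAt_tauT {M : ℂ → SMat} {S : Set ℂ} {x : ℂ}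
    (hM : ∀ i j, DifferentiableWithinAt ℂ (fun s => M s i j) S x) (n : ℕ) :
    DifferentiableWithinAt ℂ (fun s => tauT (M s) n) S x :=
  DifferentiableWithinAt.pfaffian fun a b => hM a b

theorem differentiableWithinAt_hT {M : ℂ → SMat} {S : Set ℂ} {x : ℂ}
    (hM : ∀ i j, DifferentiableWithinAt ℂ (fun s => M s i j) S x) (n : ℕ)
    (hτ : tauT (M x) n ≠ 0) :
    DifferentiableWithinAt ℂ (fun s => hT (M s) n) S x :=
  (differentiableWithinAt_tauT hM _).fun_div (differentiableWithinAt_tauT hM _) hτ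

theorem differentiableWithinAt_coeff_pPoly {M : ℂ → SMat} {S : Set ℂ} {x : ℂ}
    (hM : ∀ i j, DifferentiableWithinAt ℂ (fun s => M s i j) S x)
    (hτ : ∀ n, tauT (M x) n ≠ 0) (i j : ℕ) :
    DifferentiableWithinAt ℂ (fun s => (pPoly (M s) i).coeff j) S x := by
  have hb : ∀ (n c : ℕ) (v : ℕ → ℂ), DifferentiableWithinAt ℂ
      (fun s => pfaffian (n + 1) (borderedBy (M s) n c v)) S x := by
    refine fun n c v => DifferentiableWithinAt.pfaffian fun a b => ?_
    simp only [borderedBy, Matrix.of_apply]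
    split_ifs
    · exact differentiableWithinAt_const _
    · exact differentiableWithinAt_const _
    · exact differentiableWithinAt_const _
    · exact hM _ _
  simp only [← lcoeff_apply]
  rcases Nat.even_or_odd' i with ⟨n, rfl | rfl⟩
  · simp only [map_pPoly_even]
    exact ((differentiableWithinAt_tauT hM n).fun_inv (hτ n)).fun_mul (hb _ _ _)
  · simp only [map_pPoly_odd]
    exact (((differentiableWithinAt_tauT hM n).fun_inv (hτ n)).fun_mul (hb _ _ _)).fun_neg

/-! ### The skew-Borel decomposition -/

theorem hT_ne_zero {m : SMat} (hτ : ∀ n, tauT m n ≠ 0) (n : ℕ) : hT m n ≠ 0 :=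
  div_ne_zero (hτ _) (hτ _)

theorem root_ne_zero {m : SMat} (hτ : ∀ n, tauT m n ≠ 0) {r : ℕ → ℂ}
    (hr : ∀ n, r n ^ 2 = hT m n) (n : ℕ) : r n ≠ 0 := by
  intro h
  have := hr n
  rw [h, zero_pow two_ne_zero] at this
  exact hT_ne_zero hτ n this.symm

theorem QMat_apply (m : SMat) (r : ℕ → ℂ) (i j : ℕ) :
    QMat m r i j = (r (i / 2))⁻¹ * (pPoly m i).coeff j := by
  rw [QMat, Matrix.of_apply, qPoly, coeff_C_mul]

theorem isKWith_QMat {m : SMat} (hs : m.transpose = -m) (hτ : ∀ n, tauT m n ≠ 0) (r : ℕ → ℂ) :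
    IsKWith (fun n => (r n)⁻¹) (QMat m r) := by
  intro i j hij
  have h : (pPoly m i).coeff j = if i = j then 1 else 0 := isKWith_PMat hs hτ i j hij
  rw [QMat_apply, h]
  split_ifs <;> simp

theorem skewInner_C_mul_left (m : SMat) (a : ℂ) (f g : ℂ[X]) :
    skewInner m (C a * f) g = a * skewInner m f g := by
  simp only [skewInner_eq, Polynomial.sum, Finset.mul_sum, ← smul_eq_C_mul, map_smul, smul_eq_mul]
  exact Finset.sum_congr rfl fun j _ => by ring

theorem skewInner_qPoly {m : SMat} (hs : m.transpose = -m) (hτ : ∀ n, tauT m n ≠ 0) {r : ℕ → ℂ}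
    (hr : ∀ n, r n ^ 2 = hT m n) (i j : ℕ) :
    skewInner m (qPoly m r i) (qPoly m r j) = Jmat i j := by
  rw [qPoly, qPoly, skewInner_C_mul_left, skewInner_skew hs, skewInner_C_mul_left,
    skewInner_skew hs, skewInner_pPoly hs hτ, Jmat_smatMul, Jmat_apply, hMat,
    Matrix.diagonal_apply, partner_div]
  by_cases h : j = partner i
  · subst h
    have h0 := root_ne_zero hτ hr (i / 2)
    rw [if_pos rfl, if_pos rfl, partner_div, ← hr]
    field_simp
  · rw [if_neg (Ne.symm h), if_neg h]
    ring

theorem natDegree_qPoly_lt {m : SMat} (hs : m.transpose = -m) (hτ : ∀ n, tauT m n ≠ 0)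
    (r : ℕ → ℂ) (i : ℕ) : (qPoly m r i).natDegree < i + 1 :=
  Nat.lt_succ_of_le ((natDegree_C_mul_le _ _).trans (monic_pPoly hs hτ i).2.le)

theorem smatMul_transpose_apply {B : SMat} {j N : ℕ} (h : ∀ k, N ≤ k → B j k = 0) (A : SMat)
    (i : ℕ) : (A ⋆ B.transpose) i j = ∑ k ∈ Finset.range N, A i k * B j k := by
  have : A ⋆ B.transpose = (B ⋆ A.transpose).transpose := by rw [smatMul_transpose]; rfl
  rw [this, Matrix.transpose_apply, smatMul_apply_of_row h]
  exact Finset.sum_congr rfl fun k _ => by rw [Matrix.transpose_apply, mul_comm]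

theorem skewInner_eq_sum (m : SMat) {f g : ℂ[X]} {M N : ℕ} (hf : f.natDegree < M)
    (hg : g.natDegree < N) : skewInner m f g
      = ∑ i ∈ Finset.range M, ∑ j ∈ Finset.range N, f.coeff i * g.coeff j * m i j := by
  have h : ∀ (i : ℕ) (a : ℂ), (g.sum fun j b => a * b * m i j)
      = ∑ j ∈ Finset.range N, a * g.coeff j * m i j := fun i a =>
    sum_over_range' g (fun n => by rw [mul_zero, zero_mul]) N hg
  simp only [skewInner, h]
  exact sum_over_range' f (fun n => by simp) M hf

theorem QMat_conj {m : SMat} (hs : m.transpose = -m) (hτ : ∀ n, tauT m n ≠ 0) {r : ℕ → ℂ}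
    (hr : ∀ n, r n ^ 2 = hT m n) : QMat m r ⋆ m ⋆ (QMat m r).transpose = Jmat := by
  have hQ := isKWith_QMat hs hτ r
  ext i j
  rw [← skewInner_qPoly hs hτ hr, smatMul_transpose_apply (N := j + 1) fun k hk => hQ.eq_zero hk,
    skewInner_eq_sum m (natDegree_qPoly_lt hs hτ r i) (natDegree_qPoly_lt hs hτ r j),
    Finset.sum_comm]
  refine Finset.sum_congr rfl fun l _ => ?_
  rw [smatMul_apply_of_row (N := i + 1) fun k hk => hQ.eq_zero hk, Finset.sum_mul]
  refine Finset.sum_congr rfl fun k _ => ?_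
  rw [QMat, Matrix.of_apply, Matrix.of_apply]
  ring

/-- Multiplying `Q m Qᵀ = J` by `-J` on the right exhibits a right inverse of `Q`. The explicit
formula is used again to differentiate the inverse. -/
theorem isSkewBorel_of_conj {m Q : SMat} {c : ℕ → ℂ} (hQ : IsKWith c Q) (hc : ∀ n, c n ≠ 0)
    (h : Q ⋆ m ⋆ Q.transpose = Jmat) :
    IsSkewBorel m Q ∧ gInv Q = -(m ⋆ (Q.transpose ⋆ Jmat)) := by
  have hcol : RowFin (Q.transpose ⋆ Jmat).transpose := by
    rw [smatMul_transpose, Matrix.transpose_transpose]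
    exact rowFin_Jmat_transpose.mul hQ.rowFin
  have hright : Q ⋆ (-(m ⋆ (Q.transpose ⋆ Jmat))) = 1 := by
    rw [smatMul_neg, ← smatMul_assoc_of_col hQ.rowFin hcol, ← smatMul_assoc_of_col_col
      (B := Q.transpose) hQ.rowFin rowFin_Jmat_transpose, h, Jmat_smatMul_Jmat, neg_neg]
  obtain ⟨h1, h2⟩ := isGK_of_mul_eq_one hQ hc hright
  exact ⟨(isSkewBorel_iff h1).mpr h, h2⟩

theorem isSkewBorel_QMat {m : SMat} (hs : m.transpose = -m) (hτ : ∀ n, tauT m n ≠ 0) {r : ℕ → ℂ}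
    (hr : ∀ n, r n ^ 2 = hT m n) :
    IsSkewBorel m (QMat m r) ∧
      gInv (QMat m r) = -(m ⋆ ((QMat m r).transpose ⋆ Jmat)) :=
  isSkewBorel_of_conj (isKWith_QMat hs hτ r) (fun n => inv_ne_zero (root_ne_zero hτ hr n))
    (QMat_conj hs hτ hr)

theorem diagonal_smatMul_QMat (m : SMat) (r ε : ℕ → ℂ) (hε : ∀ n, ε n = 1 ∨ ε n = -1) :
    (Matrix.diagonal fun i => ε (i / 2)) ⋆ QMat m r = QMat m fun n => ε n * r n := by
  ext i j
  have : (ε (i / 2))⁻¹ = ε (i / 2) := by rcases hε (i / 2) with h | h <;> rw [h] <;> norm_num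
  rw [diagonal_smatMul, QMat_apply, QMat_apply, mul_inv, this, mul_assoc]

/-- The quotient `Q' Q⁻¹` lies in `𝐤`, is invertible there and preserves `J`, so
`IsKWith.eq_diagonal` applies. -/
theorem IsSkewBorel.exists_signs {m Q Q' : SMat} (h : IsSkewBorel m Q) (h' : IsSkewBorel m Q') :
    ∃ ε : ℕ → ℂ, (∀ n, ε n = 1 ∨ ε n = -1) ∧
      Q' = (Matrix.diagonal fun i => ε (i / 2)) ⋆ Q := by
  obtain ⟨c, d, hQ, hR, -, hQR, hRQ⟩ := h.1.exists_with
  obtain ⟨c', d', hQ', hR', -, hQR', hRQ'⟩ := h'.1.exists_with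
  have hm := h.2
  have hJ := (isSkewBorel_iff h'.1).mp h'
  set R := gInv Q
  set R' := gInv Q'
  have hS := hQ'.mul hR
  have hT := hQ.mul hR'
  have hTS : (Q ⋆ R') ⋆ (Q' ⋆ R) = 1 := by
    rw [smatMul_assoc hQ.rowFin hR'.rowFin, ← smatMul_assoc hR'.rowFin hQ'.rowFin, hRQ',
      one_smatMul, hQR]
  have hSJ : (Q' ⋆ R) ⋆ Jmat ⋆ (Q' ⋆ R).transpose = Jmat := by
    rw [smatMul_transpose, ← smatMul_assoc_of_col_col (B := R.transpose) (C := Q'.transpose)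
      hR.rowFin hQ'.rowFin, smatMul_assoc hQ'.rowFin hR.rowFin,
      smatMul_assoc hQ'.rowFin (hR.rowFin.mul rowFin_Jmat), ← hm, hJ]
  obtain ⟨hdiag, hsign⟩ := hS.eq_diagonal hT hTS hSJ
  refine ⟨_, hsign, ?_⟩
  rw [← hdiag, smatMul_assoc hQ'.rowFin hR.rowFin, hRQ, smatMul_one]

/-! ### The matrix `L` -/

theorem coeff_X_mul_qPoly (m : SMat) (r : ℕ → ℂ) (i l : ℕ) :
    (X * qPoly m r i).coeff l = (QMat m r ⋆ shiftMat) i l := by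
  simp only [smatMul, Matrix.of_apply, shiftMat]
  cases l with
  | zero => simp
  | succ l =>
    rw [finsum_eq_single _ l]
    · simp [QMat]
    · intro k hk
      rw [if_neg (by omega), mul_zero]

theorem coeff_finsum_qPoly (m : SMat) (r : ℕ → ℂ) {A : SMat} (hA : RowFin A) (i l : ℕ) :
    (∑ᶠ j : ℕ, C (A i j) * qPoly m r j).coeff l = (A ⋆ QMat m r) i l := by
  obtain ⟨N, hN⟩ := hA i
  rw [smatMul_apply_of_row hN, finsum_eq_sum_of_support_subset (s := Finset.range N),
    finsetSum_coeff]
  · exact Finset.sum_congr rfl fun k _ => by rw [coeff_C_mul, QMat, Matrix.of_apply]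
  · intro k hk
    rw [Finset.coe_range, Set.mem_Iio]
    by_contra h
    exact hk (by simp [hN k (not_lt.mp h)])

theorem qPoly_ne_zero {m : SMat} (hs : m.transpose = -m) (hτ : ∀ n, tauT m n ≠ 0) {r : ℕ → ℂ}
    (hr : ∀ n, r n ^ 2 = hT m n) (i : ℕ) : qPoly m r i ≠ 0 :=
  mul_ne_zero (C_ne_zero.mpr (inv_ne_zero (root_ne_zero hτ hr _))) (monic_pPoly hs hτ i).1.ne_zero

theorem eigen_iff_eq_LMat {m : SMat} (hs : m.transpose = -m) (hτ : ∀ n, tauT m n ≠ 0) {r : ℕ → ℂ}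
    (hr : ∀ n, r n ^ 2 = hT m n) (L' : SMat) :
    (∀ i : ℕ, X * qPoly m r i = ∑ᶠ j : ℕ, C (L' i j) * qPoly m r j) ↔ L' = LMat m r := by
  obtain ⟨c, d, hQ, hR, -, hQR, hRQ⟩ := (isSkewBorel_QMat hs hτ hr).1.1.exists_with
  have hΛ : RowFin shiftMat := by simpa [spow_shiftMat_one] using rowFin_spow_shiftMat 1
  constructor
  · intro h
    -- An infinite row would make the `finsum` zero by convention, since no `q_j` is zero; but `X *
    -- q_i ≠ 0`.
    have hL : RowFin L' := by
      intro i
      by_contra hN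
      push Not at hN
      have hinf : (Function.support fun j => C (L' i j) * qPoly m r j).Infinite := by
        refine Set.infinite_of_forall_exists_gt fun N => ?_
        obtain ⟨j, hj, hj'⟩ := hN (N + 1)
        exact ⟨j, mul_ne_zero (C_ne_zero.mpr hj') (qPoly_ne_zero hs hτ hr j), hj⟩
      have := h i
      rw [finsum_of_infinite_support hinf] at this
      exact mul_ne_zero X_ne_zero (qPoly_ne_zero hs hτ hr i) this
    have hLQ : L' ⋆ QMat m r = QMat m r ⋆ shiftMat := by
      ext i l
      rw [← coeff_finsum_qPoly m r hL, ← h i, coeff_X_mul_qPoly]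
    rw [LMat, ← hLQ, smatMul_assoc hL hQ.rowFin, hQR, smatMul_one]
  · rintro rfl i
    ext l
    have hL : RowFin (LMat m r) := (hQ.rowFin.mul hΛ).mul hR.rowFin
    rw [coeff_finsum_qPoly m r hL, coeff_X_mul_qPoly, LMat,
      smatMul_assoc (hQ.rowFin.mul hΛ) hR.rowFin, hRQ, smatMul_one]

/-! ### Calculus of partial derivatives within `U` -/

theorem add_single_zero (t : Times) (k : ℕ+) : t + Pi.single k (0 : ℂ) = t := by simp

/-- At an isolated point of the slice every number is a derivative. -/
theorem hasPartial_of_not_accPt {U : Set Times} {k : ℕ+} {t : Times}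
    (h : ¬ AccPt (0 : ℂ) (Filter.principal (slice U k t))) (f : Times → ℂ) (f' : ℂ) :
    HasPartial U k f f' t :=
  HasFDerivWithinAt.of_not_accPt h

theorem hasPartial_const (U : Set Times) (k : ℕ+) (a : ℂ) (t : Times) :
    HasPartial U k (fun _ => a) 0 t :=
  hasDerivWithinAt_const _ _ _

theorem HasPartial.mul {U : Set Times} {k : ℕ+} {f g : Times → ℂ} {f' g' : ℂ} {t : Times}
    (hf : HasPartial U k f f' t) (hg : HasPartial U k g g' t) :
    HasPartial U k (fun u => f u * g u) (f' * g t + f t * g') t := by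
  have := HasDerivWithinAt.fun_mul hf hg
  simp only [add_single_zero] at this
  exact this

theorem HasPartial.sum {U : Set Times} {k : ℕ+} {ι : Type*} {s : Finset ι} {f : ι → Times → ℂ}
    {f' : ι → ℂ} {t : Times} (h : ∀ i ∈ s, HasPartial U k (f i) (f' i) t) :
    HasPartial U k (fun u => ∑ i ∈ s, f i u) (∑ i ∈ s, f' i) t :=
  HasDerivWithinAt.fun_sum h

theorem HasPartial.unique {U : Set Times} {k : ℕ+} {f : Times → ℂ} {a b : ℂ} {t : Times}
    (hU : UniqueDiffWithinAt ℂ (slice U k t) 0)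
    (ha : HasPartial U k f a t) (hb : HasPartial U k f b t) : a = b :=
  hU.eq_deriv _ ha hb

theorem HasMatPartial.unique {U : Set Times} {k : ℕ+} {F : Times → SMat} {A B : SMat} {t : Times}
    (hU : UniqueDiffWithinAt ℂ (slice U k t) 0)
    (hA : HasMatPartial U k F A t) (hB : HasMatPartial U k F B t) : A = B := by
  ext i j
  exact (hA i j).unique hU (hB i j)

theorem HasMatPartial.congr {U : Set Times} {k : ℕ+} {F G : Times → SMat} {F' : SMat} {t : Times}
    (h : HasMatPartial U k F F' t) (ht : t ∈ U) (hFG : ∀ u ∈ U, G u = F u) :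
    HasMatPartial U k G F' t :=
  fun i j => (h i j).congr ht fun u hu => by rw [hFG u hu]

theorem hasMatPartial_const (U : Set Times) (k : ℕ+) (A : SMat) (t : Times) :
    HasMatPartial U k (fun _ => A) 0 t :=
  fun _ _ => hasPartial_const _ _ _ _

theorem HasMatPartial.transpose {U : Set Times} {k : ℕ+} {F : Times → SMat} {F' : SMat}
    {t : Times} (h : HasMatPartial U k F F' t) :
    HasMatPartial U k (fun u => (F u).transpose) F'.transpose t :=
  fun i j => h j i

/-- The row bound `N` is uniform over `U`, so each entry of the product is a sum of fixed length. -/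
theorem HasMatPartial.mul {U : Set Times} {k : ℕ+} {A B : Times → SMat} {A' B' : SMat} {t : Times}
    (hA : HasMatPartial U k A A' t) (hB : HasMatPartial U k B B' t) (ht : t ∈ U) (N : ℕ → ℕ)
    (hN : ∀ u ∈ U, ∀ i l, N i ≤ l → A u i l = 0) (hN' : ∀ i l, N i ≤ l → A' i l = 0) :
    HasMatPartial U k (fun u => A u ⋆ B u) (A' ⋆ B t + A t ⋆ B') t := by
  intro i j
  rw [Matrix.add_apply, smatMul_apply_of_row (hN' i), smatMul_apply_of_row (hN t ht i),
    ← Finset.sum_add_distrib]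
  exact (HasPartial.sum fun l _ => (hA i l).mul (hB l j)).congr ht fun u hu =>
    smatMul_apply_of_row (hN u hu i) _ _

theorem HasMatPartial.differentiable {U : Set Times} {k : ℕ+} {F : Times → SMat} {F' : SMat}
    {t : Times} (h : HasMatPartial U k F F' t) (i j : ℕ) :
    DifferentiableWithinAt ℂ (fun s : ℂ => F (t + Pi.single k s) i j) (slice U k t) 0 :=
  (h i j).differentiableWithinAt

/-- The difference quotient of `r` is that of `h` divided by `r s + r x`; continuity at `x` alone
suffices and no branch is chosen. -/
theorem hasDerivWithinAt_of_sq {r h : ℂ → ℂ} {S : Set ℂ} {x h' : ℂ} (hx : x ∈ S)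
    (hr : ∀ s ∈ S, r s ^ 2 = h s) (hc : ContinuousWithinAt r S x)
    (hh : HasDerivWithinAt h h' S x) (h0 : r x ≠ 0) :
    HasDerivWithinAt r (h' / (2 * r x)) S x := by
  rw [hasDerivWithinAt_iff_tendsto_slope] at hh ⊢
  have hc' : Filter.Tendsto (fun s => r s + r x) (nhdsWithin x (S \ {x})) (nhds (2 * r x)) := by
    rw [two_mul]
    exact (hc.mono Set.sdiff_subset).add_const _
  have h2 : (2 * r x) ≠ 0 := mul_ne_zero two_ne_zero h0
  refine (hh.div hc' h2).congr' ?_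
  filter_upwards [hc'.eventually_ne h2, self_mem_nhdsWithin] with s hs1 hs2
  rw [Pi.div_apply, slope_def_field, slope_def_field, ← hr s hs2.1, ← hr x hx, div_eq_iff hs1]
  ring

/-! ### Square roots along the time axes -/

theorem exists_continuous_root {U : Set Times} {m : Times → SMat}
    (hdiff : ∀ t ∈ U, ∀ k : ℕ+, ∃ F, HasMatPartial U k m F t)
    (hτ : ∀ t ∈ U, ∀ n, tauT (m t) n ≠ 0) {t : Times} (ht : t ∈ U) {c : ℕ → ℂ}
    (hc : ∀ n, c n ^ 2 = hT (m t) n) :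
    ∃ r : Times → ℕ → ℂ, r t = c ∧ (∀ u ∈ U, ∀ n : ℕ, r u n ^ 2 = hT (m u) n) ∧
      ∀ (k : ℕ+) (n : ℕ), ContAlong U k (fun u => r u n) t := by
  have h0 := hT_ne_zero (hτ t ht)
  -- The principal root is taken of `h̃(u) / h̃(t)`, which is `1` at `u = t` and so avoids the
  -- branch cut nearby; the factor `c n` prescribes the value at `t`.
  refine ⟨fun u n => c n * (hT (m u) n / hT (m t) n) ^ ((2 : ℕ)⁻¹ : ℂ), ?_, fun u _ n => ?_,
    fun k n => ?_⟩
  · ext n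
    simp only [div_self (h0 n), Complex.one_cpow, mul_one]
  · rw [mul_pow, Complex.cpow_nat_inv_pow _ two_ne_zero, hc, mul_div_cancel₀ _ (h0 n)]
  · obtain ⟨F, hF⟩ := hdiff t ht k
    have h1 : tauT (m (t + Pi.single k 0)) n ≠ 0 := by
      rw [add_single_zero]
      exact hτ t ht n
    have h2 := (differentiableWithinAt_hT hF.differentiable n h1).continuousWithinAt
    have h3 : hT (m (t + Pi.single k 0)) n / hT (m t) n ∈ Complex.slitPlane := by
      rw [add_single_zero, div_self (h0 n)]
      exact Complex.one_mem_slitPlane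
    exact continuousWithinAt_const.mul ((h2.div_const _).cpow continuousWithinAt_const h3)

/-! ### The Lax equations -/

theorem IsKWith.neg {c : ℕ → ℂ} {a : SMat} (h : IsKWith c a) : IsKWith (fun n => -c n) (-a) := by
  intro i j hij
  rw [Matrix.neg_apply, h i j hij]
  split_ifs <;> simp

/-- If `Q m Qᵀ = J` is preserved to first order by `∂m = X m + m Xᵀ`, then
`∂Q = -π_𝐤 (Q X Q⁻¹) Q`. -/
theorem piK_conj_eq {m Q R Q' X : SMat} {c d e : ℕ → ℂ} (hs : m.transpose = -m)
    (hQ : IsKWith c Q) (hR : IsKWith d R) (hQ' : IsKWith e Q') (hX : RowFin X)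
    (hRQ : R ⋆ Q = 1) (hJ : Q ⋆ (m ⋆ Q.transpose) = Jmat)
    (h : Q' ⋆ (m ⋆ Q.transpose) + Q ⋆ ((X ⋆ m + m ⋆ X.transpose) ⋆ Q.transpose
      + m ⋆ Q'.transpose) = 0) :
    piK (Q ⋆ X ⋆ R) = -(Q' ⋆ R) := by
  have hN : m ⋆ Q.transpose = R ⋆ Jmat := by
    rw [← hJ, ← smatMul_assoc hR.rowFin hQ.rowFin, hRQ, one_smatMul]
  have h1 : Q' ⋆ (m ⋆ Q.transpose) = Q' ⋆ R ⋆ Jmat := by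
    rw [hN, smatMul_assoc hQ'.rowFin hR.rowFin]
  have h2 : Q ⋆ (X ⋆ m ⋆ Q.transpose) = Q ⋆ X ⋆ R ⋆ Jmat := by
    rw [smatMul_assoc_of_col (C := Q.transpose) hX hQ.rowFin, hN, ← smatMul_assoc hQ.rowFin hX,
      ← smatMul_assoc (hQ.rowFin.mul hX) hR.rowFin]
  -- Skewness of `m` makes the terms that come from the right factor minus the transposes of those
  -- from the left.
  have hswap : ∀ {A : SMat}, RowFin A →
      Q ⋆ (m ⋆ A.transpose) = -(A ⋆ (m ⋆ Q.transpose)).transpose := by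
    intro A hA
    rw [← smatMul_assoc_of_col (C := Q.transpose) hA hQ.rowFin, smatMul_transpose,
      smatMul_transpose, Matrix.transpose_transpose, hs, neg_smatMul, smatMul_neg, neg_neg]
  have h3 : Q ⋆ (m ⋆ Q'.transpose) = -(Q' ⋆ R ⋆ Jmat).transpose := by
    rw [hswap hQ'.rowFin, h1]
  have h4 : Q ⋆ (m ⋆ X.transpose ⋆ Q.transpose) = -(Q ⋆ X ⋆ R ⋆ Jmat).transpose := by
    rw [← h2, smatMul_assoc_of_col_col (B := X.transpose) (C := Q.transpose) hX hQ.rowFin,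
      ← smatMul_transpose, hswap (hQ.rowFin.mul hX), smatMul_assoc hQ.rowFin hX,
      smatMul_assoc_of_col (C := Q.transpose) hX hQ.rowFin]
  -- With `W = Q X R + Q' R`, the hypothesis `h` now reads `W J - (W J)ᵀ = 0`.
  have hsymm : ((Q ⋆ X ⋆ R + Q' ⋆ R) ⋆ Jmat).transpose = (Q ⋆ X ⋆ R + Q' ⋆ R) ⋆ Jmat := by
    rw [add_smatMul_of_col (C := Q.transpose) hQ.rowFin, smatMul_add hQ.rowFin,
      smatMul_add hQ.rowFin, h1, h2, h3, h4] at h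
    rw [add_smatMul_of_col rowFin_Jmat_transpose, Matrix.transpose_add]
    refine (sub_eq_zero.mp ?_).symm
    rw [← h]
    abel
  refine ((piK_spec _ _).mp ⟨?_, ?_⟩).symm
  · exact (isK_iff _).mpr ⟨_, (hQ'.mul hR).neg⟩
  · rw [sub_neg_eq_add]
    exact isN_of_symm hsymm

/-- The derivative of `Q Y Q⁻¹` along `∂Q = A Q` is `[A, Q Y Q⁻¹]`. -/
theorem conj_deriv_eq_scomm {Q R Q' R' Y : SMat} {c d e : ℕ → ℂ}
    (hQ : IsKWith c Q) (hR : IsKWith d R) (hQ' : IsKWith e Q') (hY : RowFin Y)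
    (hRQ : R ⋆ Q = 1) (h : Q' ⋆ R + Q ⋆ R' = 0) :
    Q' ⋆ (Y ⋆ R) + Q ⋆ (Y ⋆ R') = scomm (Q' ⋆ R) (Q ⋆ Y ⋆ R) := by
  have hR' : R' = -(R ⋆ (Q' ⋆ R)) := by
    rw [← smatMul_neg, ← eq_neg_of_add_eq_zero_right h, ← smatMul_assoc hR.rowFin hQ.rowFin, hRQ,
      one_smatMul]
  have h1 : Q' ⋆ (Y ⋆ R) = Q' ⋆ R ⋆ (Q ⋆ Y ⋆ R) := by
    rw [smatMul_assoc hQ.rowFin hY, smatMul_assoc hQ'.rowFin hR.rowFin,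
      ← smatMul_assoc hR.rowFin hQ.rowFin, hRQ, one_smatMul]
  rw [scomm, h1, hR', smatMul_neg, smatMul_neg, ← smatMul_assoc hY hR.rowFin,
    ← smatMul_assoc hQ.rowFin (hY.mul hR.rowFin), ← smatMul_assoc hQ.rowFin hY, sub_eq_add_neg]

/-- By the formula `-m Qᵀ J`, each entry of the inverse is a sum of fixed length in entries of `m`
and `Q`. Only existence of the derivative matters: `Q Q⁻¹ = 1` determines its value. -/
theorem exists_hasMatPartial_gInv {U : Set Times} {m : Times → SMat} {Q : Times → SMat} {k : ℕ+}
    {t : Times} (ht : t ∈ U) {F Q' : SMat} (hm : HasMatPartial U k m F t)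
    (hQ' : HasMatPartial U k Q Q' t)
    (hQ : ∀ u ∈ U, ∃ c, IsKWith c (Q u))
    (hR : ∀ u ∈ U, gInv (Q u) = -(m u ⋆ ((Q u).transpose ⋆ Jmat))) :
    ∃ R', HasMatPartial U k (fun u => gInv (Q u)) R' t := by
  have hentry : ∀ u ∈ U, ∀ i j, gInv (Q u) i j
      = ∑ l ∈ Finset.range (partner j + 1), m u i l * (rowSign j * Q u (partner j) l) := by
    intro u hu i j
    obtain ⟨c, hc⟩ := hQ u hu
    have hcol : (Q u).transpose ⋆ Jmat = (-(Jmat ⋆ Q u)).transpose := by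
      rw [← neg_smatMul, ← Jmat_transpose, smatMul_transpose, Matrix.transpose_transpose]
    rw [hR u hu, hcol, Matrix.transpose_neg, smatMul_neg, neg_neg,
      smatMul_transpose_apply (N := partner j + 1)]
    · exact Finset.sum_congr rfl fun l _ => by rw [Jmat_smatMul]
    · intro l hl
      rw [Jmat_smatMul, hc.eq_zero hl, mul_zero]
  refine ⟨Matrix.of fun i j => ∑ l ∈ Finset.range (partner j + 1),
    (F i l * (rowSign j * Q t (partner j) l) +
      m t i l * (0 * Q t (partner j) l + rowSign j * Q' (partner j) l)), fun i j => ?_⟩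
  exact (HasPartial.sum fun l _ => (hm i l).mul
    ((hasPartial_const U k (rowSign j) t).mul (hQ' (partner j) l))).congr ht
    fun u hu => hentry u hu i j

/-- Uniqueness of derivatives along the slice turns constancy of `Q m Qᵀ` and of `Q Q⁻¹` into
algebraic identities at `t`. Both conclusions rest on the resulting formula for `π_𝐤 L^k`. -/
theorem lax_and_diagonal {U : Set Times} {m : Times → SMat} {r : Times → ℕ → ℂ} {k : ℕ+}
    {t : Times} (ht : t ∈ U) (hU : UniqueDiffWithinAt ℂ (slice U k t) 0)
    (hs : ∀ u ∈ U, (m u).transpose = -m u) (hτ : ∀ u ∈ U, ∀ n, tauT (m u) n ≠ 0)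
    (hr : ∀ u ∈ U, ∀ n, r u n ^ 2 = hT (m u) n)
    (hm : HasMatPartial U k m
      (spow shiftMat k ⋆ m t + m t ⋆ spow shiftMat.transpose k) t)
    (hc : ∀ n, ContAlong U k (fun u => r u n) t) :
    HasMatPartial U k (fun u => LMat (m u) (r u))
        (scomm (-piK (spow (LMat (m t) (r t)) k)) (LMat (m t) (r t))) t ∧
      ∃ dh : ℕ → ℂ, (∀ n, HasPartial U k (fun u => hT (m u) n) (dh n) t) ∧
        ∀ i j, i / 2 = j / 2 → 2 * piK (spow (LMat (m t) (r t)) k) i j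
          = if i = j then (hT (m t) (i / 2))⁻¹ * dh (i / 2) else 0 := by
  set Q : Times → SMat := fun u => QMat (m u) (r u)
  have hrne : ∀ u ∈ U, ∀ n, r u n ≠ 0 := fun u hu => root_ne_zero (hτ u hu) (hr u hu)
  have hQ : ∀ u ∈ U, IsKWith (fun n => (r u n)⁻¹) (Q u) := fun u hu =>
    isKWith_QMat (hs u hu) (hτ u hu) (r u)
  have hgk : ∀ u ∈ U, IsGK (Q u) := fun u hu =>
    (isSkewBorel_QMat (hs u hu) (hτ u hu) (hr u hu)).1.1
  have hQJ : ∀ u ∈ U, Q u ⋆ (m u ⋆ (Q u).transpose) = Jmat := fun u hu => by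
    rw [← smatMul_assoc_of_col (C := (Q u).transpose) (hQ u hu).rowFin (hQ u hu).rowFin]
    exact QMat_conj (hs u hu) (hτ u hu) (hr u hu)
  have hΛ : RowFin shiftMat := by simpa [spow_shiftMat_one] using rowFin_spow_shiftMat 1
  have hτ0 : ∀ n, tauT (m (t + Pi.single k 0)) n ≠ 0 := by
    rw [add_single_zero]
    exact hτ t ht
  have h0 : (0 : ℂ) ∈ slice U k t := by
    rw [slice, Set.mem_ofPred_eq, add_single_zero]
    exact ht
  -- derivatives of the roots and of `Q`
  choose dh hdh using fun n => (⟨_, (differentiableWithinAt_hT hm.differentiable n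
    (hτ0 n)).hasDerivWithinAt⟩ : ∃ a, HasPartial U k (fun u => hT (m u) n) a t)
  have hdr : ∀ n, HasPartial U k (fun u => r u n) (dh n / (2 * r t n)) t := by
    intro n
    have h2 : r (t + Pi.single k 0) n ≠ 0 := by
      rw [add_single_zero]
      exact hrne t ht n
    have := hasDerivWithinAt_of_sq h0 (fun s hs => hr _ hs n) (hc n) (hdh n) h2
    rw [add_single_zero] at this
    exact this
  have hdinv : ∀ n, HasPartial U k (fun u => (r u n)⁻¹)
      (-(dh n / (2 * r t n)) / r t n ^ 2) t := by
    intro n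
    have h2 : r (t + Pi.single k 0) n ≠ 0 := by
      rw [add_single_zero]
      exact hrne t ht n
    have := HasDerivWithinAt.fun_inv (hdr n) h2
    rw [add_single_zero] at this
    exact this
  have hQex : ∀ i j, ∃ a, HasPartial U k (fun u => Q u i j) a t := by
    intro i j
    have h1 : HasPartial U k (fun u => (pPoly (m u) i).coeff j) _ t :=
      (differentiableWithinAt_coeff_pPoly hm.differentiable hτ0 i j).hasDerivWithinAt
    exact ⟨_, ((hdinv (i / 2)).mul h1).congr ht fun u _ => QMat_apply _ _ _ _⟩
  obtain ⟨Q', hQ'M⟩ : ∃ Q' : SMat, HasMatPartial U k Q Q' t := by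
    choose Q' hQ' using hQex
    exact ⟨Q', hQ'⟩
  have hQ'K : IsKWith (fun n => -(dh n / (2 * r t n)) / r t n ^ 2) Q' := by
    intro i j hij
    refine (hQ'M i j).unique hU ?_
    split_ifs with h
    · exact (hdinv (i / 2)).congr ht fun u hu => by rw [hQ u hu i j hij, if_pos h]
    · exact (hasPartial_const U k 0 t).congr ht fun u hu => by rw [hQ u hu i j hij, if_neg h]
  obtain ⟨c, d, hQt, hR, hcd, hQR, hRQ⟩ := (hgk t ht).exists_with
  -- the derivative of `Q m Qᵀ = J`
  have hpiK : piK (spow (LMat (m t) (r t)) k) = -(Q' ⋆ gInv (Q t)) := by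
    have hconj : spow (LMat (m t) (r t)) k = Q t ⋆ spow shiftMat k ⋆ gInv (Q t) :=
      spow_conj hQt.rowFin hR.rowFin hΛ rowFin_spow_shiftMat hQR hRQ k
    rw [hconj]
    refine piK_conj_eq (hs t ht) hQt hR hQ'K (rowFin_spow_shiftMat k) hRQ (hQJ t ht) ?_
    have h1 : HasMatPartial U k (fun u => m u ⋆ (Q u).transpose)
        ((spow shiftMat k ⋆ m t + m t ⋆ (spow shiftMat k).transpose) ⋆ (Q t).transpose
          + m t ⋆ Q'.transpose) t := by
      -- The product rule needs finite rows on the left, so `m Qᵀ` is differentiated as the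
      -- transpose of `Q mᵀ`.
      have h2 := (hQ'M.mul hm.transpose ht (fun i => i + 1)
        (fun u hu i l hl => (hQ u hu).eq_zero hl) (fun i l hl => hQ'K.eq_zero hl)).transpose
      simp only [Matrix.transpose_add, smatMul_transpose, Matrix.transpose_transpose] at h2
      rw [spow_shiftMat_transpose, add_comm] at h2
      exact h2
    have h3 := hQ'M.mul h1 ht (fun i => i + 1)
      (fun u hu i l hl => (hQ u hu).eq_zero hl) (fun i l hl => hQ'K.eq_zero hl)
    exact h3.unique hU ((hasMatPartial_const U k Jmat t).congr ht hQJ)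
  -- the derivative of the inverse
  obtain ⟨R', hR'⟩ := exists_hasMatPartial_gInv ht hm hQ'M (fun u hu => ⟨_, hQ u hu⟩)
    (fun u hu => (isSkewBorel_QMat (hs u hu) (hτ u hu) (hr u hu)).2)
  have hQR' : Q' ⋆ gInv (Q t) + Q t ⋆ R' = 0 := by
    refine (hQ'M.mul hR' ht (fun i => i + 1) (fun u hu i l hl => (hQ u hu).eq_zero hl)
      (fun i l hl => hQ'K.eq_zero hl)).unique hU
      ((hasMatPartial_const U k 1 t).congr ht fun u hu => ?_)
    obtain ⟨_, _, _, _, _, h, _⟩ := (hgk u hu).exists_with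
    exact h
  refine ⟨?_, dh, hdh, fun i j hij => ?_⟩
  · have h1 : HasMatPartial U k (fun u => shiftMat ⋆ gInv (Q u)) (shiftMat ⋆ R') t := by
      -- Row `i` of `Λ` has its only entry in column `i + 1`, hence the bound `i + 2`.
      have h2 := (hasMatPartial_const U k shiftMat t).mul hR' ht (fun i => i + 2)
        (fun u hu i l hl => by
          simp only [shiftMat, Matrix.of_apply]
          rw [if_neg (by omega)]) (fun i l hl => rfl)
      have hzero : (0 : SMat) ⋆ gInv (Q t) = 0 := by
        ext i j
        simp [smatMul]
      rwa [hzero, zero_add] at h2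
    have h3 := hQ'M.mul h1 ht (fun i => i + 1) (fun u hu i l hl => (hQ u hu).eq_zero hl)
      (fun i l hl => hQ'K.eq_zero hl)
    rw [conj_deriv_eq_scomm hQt hR hQ'K hΛ hRQ hQR'] at h3
    rw [hpiK, neg_neg]
    exact h3.congr ht fun u hu => smatMul_assoc (hQ u hu).rowFin hΛ _
  · have hdr' : d (i / 2) = r t (i / 2) := by
      have h1 := hQt.diag i
      rw [(hQ t ht).diag i] at h1
      have h2 := hcd (i / 2)
      rw [← h1] at h2
      field_simp [hrne t ht (i / 2)] at h2
      exact h2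
    -- The diagonal of `-Q' Q⁻¹` is `(h̃' / (2r)) r⁻² · r = h̃' / (2h̃)`.
    rw [hpiK, (hQ'K.mul hR).neg i j hij.le]
    simp only [hdr', ← hr t ht]
    have := hrne t ht (i / 2)
    split_ifs
    · field_simp
    · rw [mul_zero]

end

/-! ### Assembly of the theorem. -/

theorem theorem3p1 (U : Set Times) (m : Times → SMat)
    (hskew : ∀ t ∈ U, (m t).transpose = -m t)
    (hflow : ∀ t ∈ U, ∀ k : ℕ+, HasMatPartial U k m
      (spow shiftMat k ⋆ m t + m t ⋆ spow shiftMat.transpose k) t)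
    (htau : ∀ t ∈ U, ∀ n : ℕ, tauT (m t) n ≠ 0) :
    -- the polynomials `p_k` are monic of degree `k` and skew-orthogonal
    (∀ t ∈ U,
      (∀ k : ℕ, (pPoly (m t) k).Monic ∧ (pPoly (m t) k).natDegree = k) ∧
      IsD0minus (hMat (m t)) ∧
      (Matrix.of fun i j : ℕ => skewInner (m t) (pPoly (m t) i) (pPoly (m t) j))
        = Jmat ⋆ hMat (m t)) ∧
    -- `p_{2n+1} = τ̃_{2n}⁻¹ (z + ∂/∂t₁) τ̃_{2n} p_{2n}`
    (∀ t ∈ U, ∀ n : ℕ, ∃ D : Polynomial ℂ,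
      HasPolyPartial U 1
        (fun u => Polynomial.C (tauT (m u) n) * pPoly (m u) (2 * n)) D t ∧
      pPoly (m t) (2 * n + 1) = Polynomial.C (tauT (m t) n)⁻¹ *
        (Polynomial.X * (Polynomial.C (tauT (m t) n) * pPoly (m t) (2 * n)) + D)) ∧
    -- at every point there are square roots of the `h̃_{2n}` that are continuous along all axes
    (∀ t ∈ U, ∃ r : Times → ℕ → ℂ, (∀ u ∈ U, ∀ n : ℕ, r u n ^ 2 = hT (m u) n) ∧
      ∀ (k : ℕ+) (n : ℕ), ContAlong U k (fun u => r u n) t) ∧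
    -- for every choice of square roots of the `h̃_{2n}`:
    (∀ r : Times → ℕ → ℂ, (∀ u ∈ U, ∀ n : ℕ, r u n ^ 2 = hT (m u) n) →
      ∀ t ∈ U,
        -- the `q_k` are skew-orthonormal
        ((Matrix.of fun i j : ℕ =>
            skewInner (m t) (qPoly (m t) (r t) i) (qPoly (m t) (r t) j)) = Jmat) ∧
        -- `Q` gives the skew-Borel decomposition, unique up to a sign for each `2 × 2` block
        IsSkewBorel (m t) (QMat (m t) (r t)) ∧
        (∀ Q' : SMat, IsSkewBorel (m t) Q' ↔
          ∃ ε : ℕ → ℂ, (∀ n : ℕ, ε n = 1 ∨ ε n = -1) ∧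
            Q' = (Matrix.diagonal fun i => ε (i / 2)) ⋆ QMat (m t) (r t)) ∧
        -- `L = Q Λ Q⁻¹` is the matrix determined by `z q = L q`
        (∀ L' : SMat,
          (∀ i : ℕ, Polynomial.X * qPoly (m t) (r t) i
            = ∑ᶠ j : ℕ, Polynomial.C (L' i j) * qPoly (m t) (r t) j) ↔
          L' = LMat (m t) (r t)) ∧
        -- the Lax equations
        (∀ k : ℕ+, (∀ n : ℕ, ContAlong U k (fun u => r u n) t) →
          HasMatPartial U k (fun u => LMat (m u) (r u))
            (scomm (-piK (spow (LMat (m t) (r t)) k)) (LMat (m t) (r t))) t) ∧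
        -- the equations for `h̃`
        (∀ k : ℕ+, ∃ dh : SMat, HasMatPartial U k (fun u => hMat (m u)) dh t ∧
          hMatInv (m t) ⋆ dh
            = (2 : ℂ) • piK (diagPart (spow (LMat (m t) (r t)) k)))) := by
  have hdiff : ∀ t ∈ U, ∀ k : ℕ+, ∃ F, HasMatPartial U k m F t := fun t ht k =>
    ⟨_, hflow t ht k⟩
  refine ⟨fun t ht => ⟨monic_pPoly (hskew t ht) (htau t ht), ⟨_, rfl⟩, ?_⟩, fun t ht n =>
    exists_hasPolyPartial ht (hskew t ht) (hflow t ht 1) n fun u hu => htau u hu n,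
    fun t ht => ?_, fun r hr t ht => ⟨?_, (isSkewBorel_QMat (hskew t ht) (htau t ht) (hr t ht)).1,
      fun Q' => ⟨(isSkewBorel_QMat (hskew t ht) (htau t ht) (hr t ht)).1.exists_signs, ?_⟩,
      eigen_iff_eq_LMat (hskew t ht) (htau t ht) (hr t ht), fun k hc => ?_, fun k => ?_⟩⟩
  · ext i j
    exact skewInner_pPoly (hskew t ht) (htau t ht) i j
  · choose c hc using fun n => IsAlgClosed.exists_pow_nat_eq (hT (m t) n) two_pos
    obtain ⟨r, -, hr⟩ := exists_continuous_root hdiff htau ht hc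
    exact ⟨r, hr⟩
  · ext i j
    exact skewInner_qPoly (hskew t ht) (htau t ht) (hr t ht) i j
  · rintro ⟨ε, hε, rfl⟩
    -- A change of signs is just another choice of square roots.
    rw [diagonal_smatMul_QMat _ _ _ hε]
    refine (isSkewBorel_QMat (hskew t ht) (htau t ht) fun n => ?_).1
    rw [mul_pow, hr t ht]
    rcases hε n with h | h <;> rw [h] <;> norm_num
  · by_cases hacc : AccPt (0 : ℂ) (Filter.principal (slice U k t))
    · exact (lax_and_diagonal ht hacc.uniqueDiffWithinAt hskew htau hr (hflow t ht k) hc).1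
    · exact fun i j => hasPartial_of_not_accPt hacc _ _
  · by_cases hacc : AccPt (0 : ℂ) (Filter.principal (slice U k t))
    -- The given roots need not be continuous here. They are replaced by continuous ones with the
    -- same values at `t`, which leaves `L` at `t` unchanged.
    · obtain ⟨r', hrt, hr', hc⟩ := exists_continuous_root hdiff htau ht (hr t ht)
      obtain ⟨-, dh, hdh, hdiag⟩ := lax_and_diagonal ht hacc.uniqueDiffWithinAt hskew htau hr'
        (hflow t ht k) (hc k)
      rw [hrt] at hdiag
      refine ⟨Matrix.diagonal fun i => dh (i / 2), fun i j => ?_, ?_⟩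
      · by_cases hij : i = j
        · subst hij
          simpa only [hMat, Matrix.diagonal_apply_eq] using hdh (i / 2)
        · simpa only [hMat, Matrix.diagonal_apply_ne _ hij] using hasPartial_const U k 0 t
      · ext i j
        rw [hMatInv, diagonal_smatMul, piK_diagPart, Matrix.smul_apply, smul_eq_mul, diagPart,
          Matrix.of_apply, Matrix.diagonal_apply]
        by_cases hij : i / 2 = j / 2
        · rw [if_pos hij, hdiag i j hij]
          split_ifs <;> simp
        · rw [if_neg hij, if_neg (fun h => hij (by rw [h]))]
          simp
    -- At an isolated point any matrix is a derivative, so the one solving the equation is taken.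
    · refine ⟨hMat (m t) ⋆ ((2 : ℂ) • piK (diagPart (spow (LMat (m t) (r t)) k))),
        fun i j => hasPartial_of_not_accPt hacc _ _, ?_⟩
      ext i j
      rw [hMatInv, hMat, diagonal_smatMul, diagonal_smatMul,
        inv_mul_cancel_left₀ (hT_ne_zero (htau t ht) _)]
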